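/- Let $\alpha\ge\beta\ge 0$ be fixed rational numbers. In an election with a finite set $C$ of $m\ge 1$ candidates every vote is a strict linear order on $C$. Under the scoring rule $f=(\alpha,\beta,0,\dots,0)$ (for $m$ candidates: the first $m$ entries of $\alpha,\beta,0,0,\dots$) each vote gives $\alpha$ points to the candidate it ranks first, $\beta$ points to the candidate it ranks second, and $0$ points to every other candidate; the winners are all candidates whose total number of points is maximal. The problem $f$-CCAV (constructive control by adding voters) is: given a candidate set $C$, a candidate $p\in C$, two multisets $R$ and $U$ of votes over $C$, and a number $k\in\mathbb{N}$, is there a sub-multiset $A\subseteq U$ with $|A|\le k$ such that $p$ is a winner of the election with the votes $R\cup A$ (multiset sum)? Instances are encoded as strings over a finite alphabet by listing the candidates and all votes (with multiplicity), with all numbers written in binary. Then $f$-CCAV is solvable in polynomial time: there is a (multi-stack) Turing machine, depending only on $\alpha$ and $\beta$, that decides every instance of $f$-CCAV in a number of steps bounded by a polynomial in the length of the encoded instance. -/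

import Mathlib

/-! ### Scoring rules over the rationals -/

/-- A generator: for every number `m` of candidates a scoring vector
`coeff m = (α₁, …, α_m)` of rationals with `α₁ ≥ … ≥ α_m`
(position `i + 1` on a ballot is the index `i : Fin m`). -/
structure ScoringGenerator where
  coeff : (m : ℕ) → Fin m → ℚ
  antitone : ∀ m, Antitone (coeff m)

/-- The generator `(α, β, 0, …, 0)`: for `m` candidates, the first `m` entries of
`α, β, 0, 0, …`. -/
def alphaBetaGenerator (α β : ℚ) (hβ : 0 ≤ β) (hαβ : β ≤ α) : ScoringGenerator where
  coeff _ i := if i.val = 0 then α else if i.val = 1 then β else 0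
  antitone m i j hij := by
    have hij' : i.val ≤ j.val := hij
    dsimp only
    split_ifs <;> first | omega | linarith

/-- A vote is the list of all candidates, from most to least favorite. -/
abbrev Vote := List ℕ

/-- The points that candidate `c` gains from the vote `v`: the coefficient of the position
of `c` in the scoring vector for `v.length` candidates. -/
def ScoringGenerator.points (f : ScoringGenerator) (v : Vote) (c : ℕ) : ℚ :=
  if h : v.idxOf c < v.length then f.coeff v.length ⟨v.idxOf c, h⟩ else 0

/-- The score of `c` under a multiset `V` of votes. -/
def ScoringGenerator.score (f : ScoringGenerator) (V : Multiset Vote) (c : ℕ) : ℚ :=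
  (V.map fun v => f.points v c).sum

/-- `p` is a winner (possibly one of several) of the election with candidates `C`, votes `V`. -/
def ScoringGenerator.IsWinner (f : ScoringGenerator) (C : List ℕ) (V : Multiset Vote)
    (p : ℕ) : Prop :=
  p ∈ C ∧ ∀ c ∈ C, f.score V c ≤ f.score V p

/-! ### The control problem -/

/-- An instance of constructive control by adding voters. Candidates are named by natural
numbers; `cands` lists the candidates without repetition. The multisets `R` of registered
and `U` of unregistered votes are given by listing their members with multiplicity; each vote
is a strict ranking of all candidates. -/
structure CCAVInstance where
  cands : List ℕ
  p : ℕ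
  k : ℕ
  R : List Vote
  U : List Vote
  cands_nodup : cands.Nodup
  p_mem : p ∈ cands
  R_perm : ∀ v ∈ R, v.Perm cands
  U_perm : ∀ v ∈ U, v.Perm cands

/-- `f`-CCAV: can `p` be made a winner by adding at most `k` of the votes in `U` to `R`? -/
def CCAV (f : ScoringGenerator) (I : CCAVInstance) : Prop :=
  ∃ A : Multiset Vote, A ≤ (I.U : Multiset Vote) ∧ A.card ≤ I.k ∧
    f.IsWinner I.cands ((I.R : Multiset Vote) + A) I.p

/-! ### Encoding of instances as strings -/

namespace CCAVInstance

open Computability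

/-- A natural number in binary, followed by a comma. -/
def encodeNumber (n : ℕ) : List Γ' :=
  (encodeNat n).map Γ'.bit ++ [Γ'.comma]

/-- A list of candidates (in particular, a vote) in brackets. -/
def encodeVote (v : Vote) : List Γ' :=
  Γ'.bra :: v.flatMap encodeNumber ++ [Γ'.ket]

/-- A list of votes in brackets. -/
def encodeVotes (V : List Vote) : List Γ' :=
  Γ'.bra :: V.flatMap encodeVote ++ [Γ'.ket]

/-- The string that describes an instance. -/
def encode (I : CCAVInstance) : List Γ' :=
  encodeVote I.cands ++ encodeNumber I.p ++ encodeNumber I.k ++ encodeVotes I.R ++ encodeVotes I.U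

theorem bits_append_inj {l l' : List Bool} {s s' : List Γ'}
    (h : l.map Γ'.bit ++ Γ'.comma :: s = l'.map Γ'.bit ++ Γ'.comma :: s') : l = l' ∧ s = s' := by
  induction l generalizing l' with
  | nil => cases l' <;> simp_all
  | cons a l ih =>
    cases l' with
    | nil => simp at h
    | cons b l' =>
      simp only [List.map_cons, List.cons_append, List.cons.injEq, Γ'.bit.injEq] at h
      have := ih h.2
      simp_all

theorem encodeNumber_append_inj {n n' : ℕ} {s s' : List Γ'}
    (h : encodeNumber n ++ s = encodeNumber n' ++ s') : n = n' ∧ s = s' := by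
  simp only [encodeNumber, List.append_assoc, List.singleton_append] at h
  obtain ⟨h1, h2⟩ := bits_append_inj h
  refine ⟨?_, h2⟩
  rw [← decode_encodeNat n, h1, decode_encodeNat]

theorem encodeNumber_append_ne (n : ℕ) (s s' : List Γ') :
    encodeNumber n ++ s ≠ Γ'.ket :: s' := by
  cases h : encodeNat n <;> simp [encodeNumber, h]

theorem flatMap_append_inj {X : Type} {enc : X → List Γ'}
    (hinj : ∀ {x x' : X} {s s' : List Γ'}, enc x ++ s = enc x' ++ s' → x = x' ∧ s = s')
    (hne : ∀ (x : X) (s s' : List Γ'), enc x ++ s ≠ Γ'.ket :: s')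
    {l l' : List X} {s s' : List Γ'}
    (h : l.flatMap enc ++ Γ'.ket :: s = l'.flatMap enc ++ Γ'.ket :: s') : l = l' ∧ s = s' := by
  induction l generalizing l' with
  | nil =>
    cases l' with
    | nil => simpa using h
    | cons b l' =>
      simp only [List.flatMap_cons, List.append_assoc, List.flatMap_nil, List.nil_append] at h
      exact absurd h.symm (hne _ _ _)
  | cons a l ih =>
    cases l' with
    | nil =>
      simp only [List.flatMap_cons, List.append_assoc, List.flatMap_nil, List.nil_append] at h
      exact absurd h (hne _ _ _)
    | cons b l' =>
      simp only [List.flatMap_cons, List.append_assoc] at h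
      obtain ⟨h1, h2⟩ := hinj h
      obtain ⟨h3, h4⟩ := ih h2
      exact ⟨by rw [h1, h3], h4⟩

theorem encodeVote_append_inj {v v' : Vote} {s s' : List Γ'}
    (h : encodeVote v ++ s = encodeVote v' ++ s') : v = v' ∧ s = s' := by
  simp only [encodeVote, List.cons_append, List.append_assoc, List.nil_append,
    List.cons.injEq, true_and] at h
  exact flatMap_append_inj encodeNumber_append_inj encodeNumber_append_ne h

theorem encodeVotes_append_inj {V V' : List Vote} {s s' : List Γ'}
    (h : encodeVotes V ++ s = encodeVotes V' ++ s') : V = V' ∧ s = s' := by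
  simp only [encodeVotes, List.cons_append, List.append_assoc, List.nil_append,
    List.cons.injEq, true_and] at h
  exact flatMap_append_inj encodeVote_append_inj (fun v s s' => by simp [encodeVote]) h

theorem encode_injective : Function.Injective encode := by
  intro I J h
  simp only [encode, List.append_assoc] at h
  obtain ⟨h1, h⟩ := encodeVote_append_inj h
  obtain ⟨h2, h⟩ := encodeNumber_append_inj h
  obtain ⟨h3, h⟩ := encodeNumber_append_inj h
  obtain ⟨h4, h⟩ := encodeVotes_append_inj h
  rw [← List.append_nil (encodeVotes I.U), ← List.append_nil (encodeVotes J.U)] at h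
  obtain ⟨h5, -⟩ := encodeVotes_append_inj h
  cases I
  cases J
  simp_all

open Classical in
/-- The encoding of instances over the finite alphabet `Γ'` of Mathlib; decoding is the partial
inverse of `encode`. -/
noncomputable def encoding : Encoding CCAVInstance Γ' where
  encode := encode
  decode s := if h : ∃ I, encode I = s then some h.choose else none
  decode_encode I := by
    have h : ∃ J, encode J = encode I := ⟨I, rfl⟩
    rw [dif_pos h]
    exact congrArg some (encode_injective h.choose_spec)

end CCAVInstance

/-! ### Polynomial time -/

/-- A decision problem `P`, whose instances are given as strings over a finite alphabet by `e`,
is solvable in polynomial time: some Turing machine (with finitely many stacks), started on the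
code of an arbitrary instance `x`, halts with output `true` if `P x` holds and with output `false`
otherwise, after a number of steps bounded by a fixed polynomial in the length of the code. -/
def SolvableInPolyTime {X Γ : Type} [Fintype Γ] (e : Computability.Encoding X Γ)
    (P : X → Prop) : Prop :=
  ∃ g : X → Bool, (∀ x, g x = true ↔ P x) ∧
    Nonempty (Turing.TM2ComputableInPolyTime e.encode Computability.encodeBool g)

/-! ### Stack programs -/

/-! After multiplication by a common denominator the points are natural numbers `a`, `b`
(`exists_nat_scaling`). An added vote that ranks `p` below second place gives `p` nothing, so
deleting it never hurts. Every remaining vote is described by its first two places: `p` then `c`, or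
`c` then `p`. Let `x c` and `y c` be the numbers of added votes of these two kinds. The score of `p`
depends only on the totals of `x` and `y`, and that of a rival `c` only on `x c` and `y c`. Any `x`,
`y` bounded by the supply in `U` can be realised, so only these numbers matter (`exists_votes_iff`).

Once the two totals `q` are guessed, the conditions on different candidates are independent: one
asks for an admissible pair for each candidate such that the pairs add up to `q`. This is a dynamic
program over the candidates, whose table is a subset of a grid of side `U.length + 1`, hence of
polynomial size (`mem_foldl_extend`, `canWin_iff`). The limit `k` is given in binary and may be
huge, but can be replaced by its minimum with the number of votes in `U`, after which all counting
is done in unary.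

For the machine, structured programs over four stacks are compiled to a Turing machine with exact
step counts (`Exec.steps`, `StackProg.solvableInPolyTime`). All data are binary trees, and
`PolyTime` says that a program replaces the tree of the argument on a stack by the tree of the value
in polynomial time. This notion is closed under composition, pairing, branching and folds with
controlled growth of the state (`PolyTime.foldl`); the parser and the dynamic program are assembled
from these. -/

open Computability in
/-- Structured programs over four stacks with symbols in `Γ'`. -/
inductive StackProg : Type
  /-- do nothing -/
  | skip
  /-- push a symbol on a stack -/
  | push (k : Fin 4) (a : Γ')
  /-- run two programs one after the other -/
  | seq (p q : StackProg)
  /-- pop a symbol and branch on it -/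
  | case (k : Fin 4) (f : Option Γ' → StackProg)
  /-- pop symbols and run the program that belongs to each of them, until the stack is empty
  or the popped symbol satisfies `exits` -/
  | loop (k : Fin 4) (exits : Γ' → Bool) (f : Γ' → StackProg)

namespace StackProg

open Computability Turing

/-- The contents of the four stacks. -/
abbrev Store := Fin 4 → List Γ'

/-- `p.Exec s s' t`: the program `p`, started with stacks `s`, stops with stacks `s'` after
`t` steps. -/
inductive Exec : StackProg → Store → Store → ℕ → Prop
  | skip (s) : Exec skip s s 1
  | push (k a s) : Exec (push k a) s (Function.update s k (a :: s k)) 1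
  | seq {p q s s' s'' t t'} (h : Exec p s s' t) (h' : Exec q s' s'' t') :
      Exec (seq p q) s s'' (t + t')
  | case {k f s s' t} (h : Exec (f (s k).head?) (Function.update s k (s k).tail) s' t) :
      Exec (case k f) s s' (t + 1)
  | loop_empty {k exits f s} (h : s k = []) :
      Exec (loop k exits f) s s 1
  | loop_exit {k exits f s a l} (h : s k = a :: l) (ha : exits a = true) :
      Exec (loop k exits f) s (Function.update s k l) 1
  | loop_step {k exits f s s' s'' t t' a l} (h : s k = a :: l) (ha : exits a = false)
      (hf : Exec (f a) (Function.update s k l) s' t) (hl : Exec (loop k exits f) s' s'' t') :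
      Exec (loop k exits f) s s'' (t + t' + 1)

/-- The labels of the machine that runs a program. -/
def Label : StackProg → Type
  | skip => Unit
  | push _ _ => Unit
  | seq p q => Label p ⊕ Label q
  | case _ f => Option (Σ o, Label (f o))
  | loop _ _ f => Option (Σ a, Label (f a))

theorem finite_label (p : StackProg) : Finite p.Label := by
  induction p with
  | skip => exact inferInstanceAs (Finite Unit)
  | push => exact inferInstanceAs (Finite Unit)
  | seq p q hp hq => exact inferInstanceAs (Finite (p.Label ⊕ q.Label))
  | case k f hf => exact inferInstanceAs (Finite (Option (Σ o, Label (f o))))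
  | loop k exits f hf => exact inferInstanceAs (Finite (Option (Σ a, Label (f a))))

/-- The label at which a program starts. -/
def start : (p : StackProg) → Label p
  | skip => ()
  | push _ _ => ()
  | seq p _ => Sum.inl (start p)
  | case _ _ => none
  | loop _ _ _ => none

/-- The alphabets of the stacks of the machine: besides the four stacks of the program there is
an output stack. -/
abbrev StackAlphabet : Option (Fin 4) → Type
  | none => Bool
  | some _ => Γ'

/-- The stacks of the machine. -/
def machineStacks (s : Store) (o : List Bool) : ∀ k, List (StackAlphabet k)
  | none => o
  | some k => s k

/-- The statements of the machine. -/
abbrev MachineStmt (Λ : Type) := TM2.Stmt StackAlphabet Λ (Option Γ')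

/-- The statement at each label of a program, if the labels of the program are embedded by `ι`
into the labels of the machine and `next` is the label that follows the program. -/
def stmt {Λ : Type} : (p : StackProg) → (ι : Label p → Λ) → (next : Λ) → Label p → MachineStmt Λ
  | skip, _, next, _ => .goto fun _ => next
  | push k a, _, next, _ => .push (some k) (fun _ => a) (.goto fun _ => next)
  | seq p q, ι, _, Sum.inl l => stmt p (fun l => ι (Sum.inl l)) (ι (Sum.inr (start q))) l
  | seq _ q, ι, next, Sum.inr l => stmt q (fun l => ι (Sum.inr l)) next l
  | case k f, ι, _, none =>
    .pop (some k) (fun _ o => o) (.goto fun v => ι (some ⟨v, start (f v)⟩))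
  | case _ f, ι, next, some ⟨o, l⟩ => stmt (f o) (fun l => ι (some ⟨o, l⟩)) next l
  | loop k exits f, ι, next, none =>
    .pop (some k) (fun _ o => o) (.goto fun v =>
      match v with
      | none => next
      | some a => if exits a then next else ι (some ⟨a, start (f a)⟩))
  | loop _ _ f, ι, _, some ⟨a, l⟩ => stmt (f a) (fun l => ι (some ⟨a, l⟩)) (ι none) l

/-- `Steps m c c' t`: the machine `m` reaches `c'` from `c` in `t` steps. -/
def Steps {Λ : Type} (m : Λ → MachineStmt Λ) (c c' : TM2.Cfg StackAlphabet Λ (Option Γ'))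
    (t : ℕ) : Prop :=
  (flip bind (TM2.step m))^[t] (some c) = some c'

theorem Steps.trans {Λ : Type} {m : Λ → MachineStmt Λ}
    {c c' c'' : TM2.Cfg StackAlphabet Λ (Option Γ')} {t t' : ℕ}
    (h : Steps m c c' t) (h' : Steps m c' c'' t') : Steps m c c'' (t + t') := by
  unfold Steps at *
  rw [Nat.add_comm, Function.iterate_add_apply, h, h']

theorem Steps.single {Λ : Type} {m : Λ → MachineStmt Λ}
    {c c' : TM2.Cfg StackAlphabet Λ (Option Γ')} (h : TM2.step m c = some c') :
    Steps m c c' 1 := h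

theorem update_machineStacks (s : Store) (o : List Bool) (k : Fin 4) (l : List Γ') :
    Function.update (machineStacks s o) (some k) l = machineStacks (Function.update s k l) o := by
  funext k'
  cases k' with
  | none => rfl
  | some k' =>
    by_cases h : k' = k
    · subst h
      simp [machineStacks]
    · rw [Function.update_of_ne (by simpa using h)]
      simp [machineStacks, h]

/-- The machine runs a program as prescribed by `Exec`. -/
theorem Exec.steps {Λ : Type} {m : Λ → MachineStmt Λ} {p : StackProg} {s s' : Store} {t : ℕ}
    (h : Exec p s s' t) {ι : Label p → Λ} {next : Λ} (hm : ∀ l, m (ι l) = stmt p ι next l)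
    (v : Option Γ') (o : List Bool) : ∃ v',
    Steps m ⟨some (ι p.start), v, machineStacks s o⟩ ⟨some next, v', machineStacks s' o⟩ t := by
  induction h generalizing next v with
  | skip s =>
    refine ⟨v, Steps.single ?_⟩
    rw [TM2.step, hm]
    rfl
  | push k a s =>
    refine ⟨v, Steps.single ?_⟩
    rw [TM2.step, hm, ← update_machineStacks]
    rfl
  | @seq p q _ _ _ _ _ _ _ ih ih' =>
    obtain ⟨v', h⟩ := ih (ι := fun l => ι (Sum.inl l)) (fun l => hm (Sum.inl l)) v
    obtain ⟨v'', h'⟩ := ih' (ι := fun l => ι (Sum.inr l)) (fun l => hm (Sum.inr l)) v'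
    exact ⟨v'', h.trans h'⟩
  | @case k f s _ t h ih =>
    obtain ⟨v', h⟩ := ih (ι := fun l => ι (some ⟨_, l⟩)) (fun l => hm (some ⟨_, l⟩)) (s k).head?
    refine ⟨v', ?_⟩
    rw [Nat.add_comm]
    refine Steps.trans (Steps.single ?_) h
    rw [TM2.step, hm, ← update_machineStacks]
    rfl
  | @loop_empty k exits f s h =>
    refine ⟨none, Steps.single ?_⟩
    -- Popping an empty stack still overwrites it by its tail, so the target configuration is put in
    -- that form.
    have hs : machineStacks s o = Function.update (machineStacks s o) (some k) (s k).tail := by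
      rw [update_machineStacks, Function.update_eq_self_iff.2 (by simp [h])]
    have hh : (machineStacks s o (some k)).head? = none := by simp [machineStacks, h]
    rw [TM2.step, hm]
    conv_rhs => rw [hs]
    simp only [start, stmt, TM2.stepAux]
    rw [hh]
    rfl
  | @loop_exit k exits f s a l h ha =>
    refine ⟨some a, Steps.single ?_⟩
    have hh : (machineStacks s o (some k)).head? = some a := by simp [machineStacks, h]
    have ht : (machineStacks s o (some k)).tail = l := by simp [machineStacks, h]
    rw [TM2.step, hm, ← update_machineStacks]
    simp only [start, stmt, TM2.stepAux]
    rw [hh, ht]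
    simp [ha]
  | @loop_step k exits f s s' s'' t t' a l h ha hf hl ih ih' =>
    obtain ⟨v', h1⟩ := ih (ι := fun l => ι (some ⟨a, l⟩)) (fun l => hm (some ⟨a, l⟩)) (some a)
    obtain ⟨v'', h2⟩ := ih' hm v'
    refine ⟨v'', ?_⟩
    rw [Nat.add_comm]
    refine Steps.trans (Steps.single ?_) (h1.trans h2)
    have hh : (machineStacks s o (some k)).head? = some a := by simp [machineStacks, h]
    have ht : (machineStacks s o (some k)).tail = l := by simp [machineStacks, h]
    rw [TM2.step, hm, ← update_machineStacks]
    simp only [start, stmt, TM2.stepAux]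
    rw [hh, ht]
    simp [ha]

/-- The machine that runs `p` on the input stack `1`, then moves the answer from the top of
stack `0` to the output stack. -/
noncomputable def machine (p : StackProg) : FinTM2 :=
  letI := p.finite_label
  { K := Option (Fin 4)
    k₀ := some 1
    k₁ := none
    Γ := StackAlphabet
    Λ := Option p.Label
    ΛFin := Fintype.ofFinite _
    main := some p.start
    σ := Option Γ'
    initialState := none
    Γk₀Fin := inferInstanceAs (Fintype Γ')
    m := fun l =>
      match l with
      | some l => stmt p some none l
      | none =>
        -- The variable is reset at the end because a halting configuration must carry the initial
        -- state.
        .pop (some 0) (fun _ o => o)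
          (.push none (fun v => decide (v = some (Γ'.bit true))) (.load (fun _ => none) .halt)) }

/-- A program that computes a predicate in polynomial time gives a machine that does so. -/
theorem solvableInPolyTime {X : Type} (e : Encoding X Γ') (P : X → Prop) (p : StackProg)
    (time : Polynomial ℕ) (g : X → Bool) (hg : ∀ x, g x = true ↔ P x)
    (h : ∀ x, ∃ t ≤ time.eval (e.encode x).length,
      Exec p ![[], e.encode x, [], []] ![[Γ'.bit (g x)], [], [], []] t) :
    SolvableInPolyTime e P := by
  refine ⟨g, hg, ⟨{
    tm := p.machine
    inputAlphabet := Equiv.refl Γ'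
    outputAlphabet := Equiv.refl Bool
    time := time + 1
    outputsFun := fun x => Classical.choice ?_ }⟩⟩
  obtain ⟨t, ht, hx⟩ := h x
  obtain ⟨v, hv⟩ := hx.steps (m := p.machine.m) (ι := some) (next := none) (fun l => rfl) none []
  -- The extra step moves the answer to the output stack and halts.
  refine ⟨⟨⟨t + 1, ?_⟩, by simpa using ht⟩⟩
  have h0 : initList p.machine (List.map (Equiv.refl Γ').invFun (e.encode x)) =
      ⟨some (some p.start), none, machineStacks ![[], e.encode x, [], []] []⟩ := by
    have hmap : List.map (Equiv.refl Γ').invFun (e.encode x) = e.encode x := List.map_id _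
    refine (congrArg (initList p.machine) hmap).trans ?_
    unfold initList
    congr 1
    funext k
    cases k with
    | none => rfl
    | some k => fin_cases k <;> rfl
  have h1 : haltList p.machine (List.map (Equiv.refl Bool).invFun (encodeBool (g x))) =
      ⟨none, none, machineStacks ![[], [], [], []] [g x]⟩ := by
    have hmap : List.map (Equiv.refl Bool).invFun (encodeBool (g x)) = [g x] := rfl
    refine (congrArg (haltList p.machine) hmap).trans ?_
    unfold haltList
    congr 1
    funext k
    cases k with
    | none => rfl
    | some k => fin_cases k <;> rfl
  refine (congrArg _ (congrArg some h0)).trans (Eq.trans ?_ (congrArg some h1).symm)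
  refine hv.trans (Steps.single ?_)
  have hst : TM2.stepAux (p.machine.m none) v
      (machineStacks ![[Γ'.bit (g x)], [], [], []] []) =
      ⟨none, none, machineStacks ![[], [], [], []] [g x]⟩ := by
    simp only [machine, TM2.stepAux]
    congr 1
    funext k
    cases k with
    | none => cases g x <;> simp [machineStacks] <;> rfl
    | some k => fin_cases k <;> simp [machineStacks, Function.update]
  exact congrArg some hst

end StackProg

namespace StackProg

open Computability

/-! ### Running times of simple programs -/

/-- `p.Runs s s' n`: the program `p`, started with stacks `s`, stops with stacks `s'` after
at most `n` steps. -/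
def Runs (p : StackProg) (s s' : Store) (n : ℕ) : Prop := ∃ t ≤ n, Exec p s s' t

variable {p q : StackProg} {s s' s'' : Store} {n n' : ℕ}

theorem Runs.mono (h : Runs p s s' n) (hn : n ≤ n') : Runs p s s' n' :=
  let ⟨t, ht, h⟩ := h
  ⟨t, ht.trans hn, h⟩

theorem Runs.cast (h : Runs p s s' n) (hs : s'' = s) : Runs p s'' s' n := hs ▸ h

theorem runs_skip (s : Store) : Runs skip s s 1 := ⟨1, le_rfl, .skip s⟩

theorem runs_push (k : Fin 4) (a : Γ') (s : Store) :
    Runs (push k a) s (Function.update s k (a :: s k)) 1 := ⟨1, le_rfl, .push k a s⟩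

theorem Runs.seq (h : Runs p s s' n) (h' : Runs q s' s'' n') :
    Runs (seq p q) s s'' (n + n') :=
  let ⟨t, ht, h⟩ := h
  let ⟨t', ht', h'⟩ := h'
  ⟨t + t', Nat.add_le_add ht ht', .seq h h'⟩

theorem runs_case {k : Fin 4} {f : Option Γ' → StackProg}
    (h : Runs (f (s k).head?) (Function.update s k (s k).tail) s' n) :
    Runs (case k f) s s' (n + 1) :=
  let ⟨t, ht, h⟩ := h
  ⟨t + 1, Nat.add_le_add_right ht 1, .case h⟩

theorem runs_loop_empty {k : Fin 4} {exits : Γ' → Bool} {f : Γ' → StackProg} (h : s k = []) :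
    Runs (loop k exits f) s s 1 := ⟨1, le_rfl, .loop_empty h⟩

theorem runs_loop_exit {k : Fin 4} {exits : Γ' → Bool} {f : Γ' → StackProg} {a : Γ'} {l : List Γ'}
    (h : s k = a :: l) (ha : exits a = true) :
    Runs (loop k exits f) s (Function.update s k l) 1 := ⟨1, le_rfl, .loop_exit h ha⟩

theorem runs_loop_step {k : Fin 4} {exits : Γ' → Bool} {f : Γ' → StackProg} {a : Γ'}
    {l : List Γ'} (h : s k = a :: l) (ha : exits a = false)
    (hf : Runs (f a) (Function.update s k l) s' n) (hl : Runs (loop k exits f) s' s'' n') :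
    Runs (loop k exits f) s s'' (n + n' + 1) :=
  let ⟨t, ht, hf⟩ := hf
  let ⟨t', ht', hl⟩ := hl
  ⟨t + t' + 1, by omega, .loop_step h ha hf hl⟩

section store

variable (m b c d l : List Γ')

@[simp] theorem update_store_zero :
    Function.update (![m, b, c, d] : Store) 0 l = ![l, b, c, d] := by
  funext i
  fin_cases i <;> rfl

@[simp] theorem update_store_one : Function.update (![m, b, c, d] : Store) 1 l = ![m, l, c, d] := by
  funext i
  fin_cases i <;> rfl

@[simp] theorem update_store_two : Function.update (![m, b, c, d] : Store) 2 l = ![m, b, l, d] := by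
  funext i
  fin_cases i <;> rfl

@[simp] theorem update_store_three :
    Function.update (![m, b, c, d] : Store) 3 l = ![m, b, c, l] := by
  funext i
  fin_cases i <;> rfl

end store

/-- Move the contents of stack `k` to stack `k'`, reversing their order. -/
def pour (k k' : Fin 4) : StackProg := loop k (fun _ => false) (fun a => push k' a)

theorem runs_pour {k k' : Fin 4} (hk : k ≠ k') (l : List Γ') (s : Store) (h : s k = l) :
    Runs (pour k k') s (Function.update (Function.update s k []) k' (l.reverse ++ s k'))
      (2 * l.length + 1) := by
  induction l generalizing s with
  | nil =>
    have hs : Function.update (Function.update s k []) k' ([].reverse ++ s k') = s := by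
      rw [show Function.update s k [] = s from Function.update_eq_self_iff.2 h.symm]
      simp
    rw [hs]
    exact runs_loop_empty h
  | cons a l ih =>
    have := ih (Function.update (Function.update s k l) k' (a :: s k')) (by simp [hk])
    refine Runs.mono (runs_loop_step h rfl (s' := Function.update (Function.update s k l) k'
      (a :: s k')) ?_ (s'' := _) ?_) (n := 1 + (2 * l.length + 1) + 1) (by simp; omega)
    · simpa [hk.symm] using runs_push k' a (Function.update s k l)
    · refine (congrArg (Runs _ _ · _) ?_).mp this
      funext i
      by_cases h1 : i = k' <;> by_cases h2 : i = k <;> simp [Function.update_apply, h1, h2]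

section

variable (l m b c d : List Γ')

theorem runs_pour_one_two :
    Runs (pour 1 2) ![m, l, c, d] ![m, [], l.reverse ++ c, d] (2 * l.length + 1) := by
  simpa using runs_pour (k := 1) (k' := 2) (by decide) l ![m, l, c, d] rfl

theorem runs_pour_two_one :
    Runs (pour 2 1) ![m, b, l, d] ![m, l.reverse ++ b, [], d] (2 * l.length + 1) := by
  simpa using runs_pour (k := 2) (k' := 1) (by decide) l ![m, b, l, d] rfl

theorem runs_pour_one_zero :
    Runs (pour 1 0) ![m, l, c, d] ![l.reverse ++ m, [], c, d] (2 * l.length + 1) := by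
  simpa using runs_pour (k := 1) (k' := 0) (by decide) l ![m, l, c, d] rfl

theorem runs_pour_two_three :
    Runs (pour 2 3) ![m, b, l, d] ![m, b, [], l.reverse ++ d] (2 * l.length + 1) := by
  simpa using runs_pour (k := 2) (k' := 3) (by decide) l ![m, b, l, d] rfl

theorem runs_pour_three_two :
    Runs (pour 3 2) ![m, b, c, l] ![m, b, l.reverse ++ c, []] (2 * l.length + 1) := by
  simpa using runs_pour (k := 3) (k' := 2) (by decide) l ![m, b, c, l] rfl

end

/-- Empty a stack. -/
def clear (k : Fin 4) : StackProg := loop k (fun _ => false) (fun _ => skip)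

theorem runs_clear {k : Fin 4} (l : List Γ') (s : Store) (h : s k = l) :
    Runs (clear k) s (Function.update s k []) (2 * l.length + 1) := by
  induction l generalizing s with
  | nil =>
    rw [Function.update_eq_self_iff.2 h.symm]
    exact runs_loop_empty h
  | cons a l ih =>
    have := ih (Function.update s k l) (by simp)
    rw [Function.update_idem] at this
    exact Runs.mono (runs_loop_step h rfl (runs_skip _) this) (by simp; omega)

/-- Push a list of symbols. -/
def pushList (k : Fin 4) : List Γ' → StackProg
  | [] => skip
  | a :: l => seq (pushList k l) (push k a)

theorem runs_pushList (k : Fin 4) (l : List Γ') (s : Store) :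
    Runs (pushList k l) s (Function.update s k (l ++ s k)) (l.length + 1) := by
  induction l with
  | nil => simpa [pushList] using runs_skip s
  | cons a l ih =>
    refine Runs.mono (ih.seq (s'' := _) (n' := 1) ?_) (by simp)
    convert runs_push k a _ using 1
    simp

end StackProg

/-! ### Binary trees on the stacks -/

/-- Binary trees, in which all data are coded. -/
inductive BinTree : Type
  | nil
  | cons (a b : BinTree)
  deriving DecidableEq

namespace BinTree

open Computability

/-- The string that describes a tree. -/
def code : BinTree → List Γ'
  | nil => [Γ'.bit false]
  | cons a b => Γ'.bit true :: (code a ++ code b)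

/-- The size of a tree. -/
def size (a : BinTree) : ℕ := a.code.length

@[simp] theorem size_nil : nil.size = 1 := rfl

@[simp] theorem size_cons (a b : BinTree) : (cons a b).size = a.size + b.size + 1 := by
  simp [size, code]

theorem length_code (a : BinTree) : a.code.length = a.size := rfl

theorem size_pos (a : BinTree) : 0 < a.size := by
  cases a <;> simp

/-- Preorder codes are prefix-free, so the end of a tree is visible without a separator. -/
theorem code_append_inj {a b : BinTree} {r r' : List Γ'} (h : a.code ++ r = b.code ++ r') :
    a = b ∧ r = r' := by
  induction a generalizing b r r' with
  | nil => cases b <;> simp_all [code]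
  | cons a a' ih ih' =>
    cases b with
    | nil => simp [code] at h
    | cons b b' =>
      simp only [code, List.cons_append, List.append_assoc, List.cons.injEq, true_and] at h
      obtain ⟨h1, h⟩ := ih h
      obtain ⟨h2, h⟩ := ih' h
      exact ⟨by rw [h1, h2], h⟩

theorem code_injective : Function.Injective code := fun a b h =>
  (code_append_inj (r := []) (r' := []) (by simp [h])).1

/-- The left subtree. -/
def left : BinTree → BinTree
  | nil => nil
  | cons a _ => a

/-- The right subtree. -/
def right : BinTree → BinTree
  | nil => nil
  | cons _ b => b

/-- The trees that stand for truth values. -/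
def ofBool : Bool → BinTree
  | false => nil
  | true => cons nil nil

end BinTree

/-! ### Moving, copying and comparing trees on the stacks -/

namespace StackProg

open Computability BinTree

/-- The loop that moves trees from stack `0` to stack `1`; stack `3` counts the trees. -/
def moveTrees : StackProg :=
  loop 3 (fun _ => false) fun _ =>
    case 0 fun o =>
      match o with
      | none => skip
      | some a => seq (push 1 a)
          (if a = Γ'.bit true then seq (push 3 a) (push 3 a) else skip)

/-- Stack `3` holds one symbol for each tree still to be moved; an inner node uses up one and adds
two for its subtrees. Stating the claim for an arbitrary continuation `h` lets the two subtrees be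
handled in succession. Each symbol of the code costs at most 5 steps. -/
theorem runs_moveTrees (a : BinTree) (m b c d : List Γ') (x : Γ') (s : Store) (n : ℕ)
    (h : Runs moveTrees ![m, a.code.reverse ++ b, c, d] s n) :
    Runs moveTrees ![a.code ++ m, b, c, x :: d] s (n + 5 * a.size) := by
  induction a generalizing m b c d x n with
  | nil =>
    refine Runs.mono (runs_loop_step (n := 3) (a := x) (l := d) rfl rfl ?_ h) (by simp; omega)
    refine runs_case (n := 2) ?_
    simpa [code] using (runs_push 1 (Γ'.bit false) ![m, b, c, d]).seq (runs_skip _)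
  | cons a a' ih ih' =>
    have h2 := ih (a'.code ++ m) (Γ'.bit true :: b) c (Γ'.bit true :: d) (Γ'.bit true) _
      (ih' m (a.code.reverse ++ Γ'.bit true :: b) c d (Γ'.bit true) n
        (by simpa [code] using h))
    refine Runs.mono (runs_loop_step (n := 4) (a := x) (l := d) rfl rfl ?_ h2) (by simp; omega)
    refine runs_case (n := 3) ?_
    simpa [code] using (runs_push 1 (Γ'.bit true) ![a.code ++ (a'.code ++ m), b, c, d]).seq
      ((runs_push 3 (Γ'.bit true) _).seq (runs_push 3 (Γ'.bit true) _))

/-- Move the tree on the top of stack `0` to stack `1`. -/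
def moveTree : StackProg := seq (push 3 Γ'.blank) moveTrees

theorem runs_moveTree (a : BinTree) (m b c : List Γ') :
    Runs moveTree ![a.code ++ m, b, c, []] ![m, a.code.reverse ++ b, c, []] (5 * a.size + 2) := by
  refine Runs.mono (Runs.seq (runs_push _ _ _) (n' := 1 + 5 * a.size) ?_) (by omega)
  simpa using runs_moveTrees a m b c [] Γ'.blank _ 1 (runs_loop_empty rfl)

/-- Stacks that hold only the strings on stack `0`. -/
abbrev mainStack (m : List Γ') : Store := ![m, [], [], []]

/-- Delete the tree on the top. -/
def dropTree : StackProg := seq moveTree (clear 1)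

theorem runs_dropTree (a : BinTree) (m : List Γ') :
    Runs dropTree (mainStack (a.code ++ m)) (mainStack m) (7 * a.size + 3) := by
  refine Runs.mono (Runs.seq (runs_moveTree a m [] [])
    (s'' := _) (n' := 2 * a.size + 1) ?_) (by omega)
  simpa [length_code] using runs_clear (k := 1) _ ![m, a.code.reverse, [], []] rfl

/-- Swap the two trees on the top. -/
def swapTrees : StackProg :=
  seq moveTree (seq (pour 1 2) (seq moveTree (seq (pour 2 1) (pour 1 0))))

theorem runs_swapTrees (a b : BinTree) (m : List Γ') :
    Runs swapTrees (mainStack (a.code ++ (b.code ++ m))) (mainStack (b.code ++ (a.code ++ m)))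
      (11 * a.size + 7 * b.size + 7) := by
  have h1 := runs_moveTree a (b.code ++ m) [] []
  have h2 := runs_pour_one_two a.code.reverse (b.code ++ m) [] []
  have h3 := runs_moveTree b m [] a.code
  have h4 := runs_pour_two_one a.code m b.code.reverse []
  have h5 := runs_pour_one_zero (a.code.reverse ++ b.code.reverse) m [] []
  simp only [List.append_nil, List.reverse_reverse, List.length_reverse, List.length_append,
    length_code, List.reverse_append, List.append_assoc] at h1 h2 h3 h4 h5
  exact Runs.mono (h1.seq (h2.seq (h3.seq (h4.seq h5)))) (by omega)

/-- Empty stack `1` on both of the stacks `0` and `2`. -/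
def fork : StackProg := loop 1 (fun _ => false) fun a => seq (push 0 a) (push 2 a)

theorem runs_fork (l m c : List Γ') :
    Runs fork ![m, l, c, []] ![l.reverse ++ m, [], l.reverse ++ c, []] (3 * l.length + 1) := by
  induction l generalizing m c with
  | nil => exact runs_loop_empty rfl
  | cons a l ih =>
    have h := runs_loop_step (k := 1) (exits := fun _ => false) (s := ![m, a :: l, c, []])
      (f := fun a => seq (push 0 a) (push 2 a)) rfl rfl
      ((runs_push 0 a _).seq (runs_push 2 a _)) (by simpa [fork] using ih (a :: m) (a :: c))
    simpa [fork] using h.mono (n' := 3 * (a :: l).length + 1) (by simp; omega)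

/-- Duplicate the tree on the top. -/
def dupTree : StackProg := seq moveTree (seq fork (seq (pour 2 1) (pour 1 0)))

theorem runs_dupTree (a : BinTree) (m : List Γ') :
    Runs dupTree (mainStack (a.code ++ m)) (mainStack (a.code ++ (a.code ++ m)))
      (12 * a.size + 5) := by
  have h1 := runs_moveTree a m [] []
  have h2 := runs_fork a.code.reverse m []
  have h3 := runs_pour_two_one a.code (a.code ++ m) [] []
  have h4 := runs_pour_one_zero a.code.reverse (a.code ++ m) [] []
  simp only [List.append_nil, List.reverse_reverse, List.length_reverse, length_code] at h1 h2 h3 h4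
  exact Runs.mono (h1.seq (h2.seq (h3.seq h4))) (by omega)

/-- Compare the strings on the stacks `1` and `3`; stack `2` gets a symbol if they differ. -/
def compareStacks : StackProg :=
  seq (loop 1 (fun _ => false) fun a => case 3 fun o => if o = some a then skip else push 2 a)
    (pour 3 2)

/-- Each mismatch leaves a mark on stack `2`, and so does each symbol of `l'` left over at the end.
The induction in `key` therefore starts from arbitrary earlier marks `c`. -/
theorem runs_compareStacks (l l' m : List Γ') :
    ∃ c, Runs compareStacks ![m, l, [], l'] ![m, [], c, []] (3 * l.length + 2 * l'.length + 2) ∧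
      c.length ≤ l.length + l'.length ∧ (c = [] ↔ l = l') := by
  have key : ∀ l l' c : List Γ', ∃ c' d, Runs (loop 1 (fun _ => false) fun a =>
      case 3 fun o => if o = some a then skip else push 2 a) ![m, l, c, l'] ![m, [], c', d]
        (3 * l.length + 1) ∧ c'.length ≤ l.length + c.length ∧ d.length ≤ l'.length ∧
        (c' = [] ∧ d = [] ↔ c = [] ∧ l = l') := by
    intro l
    induction l with
    | nil => exact fun l' c => ⟨c, l', runs_loop_empty rfl, by simp, by simp, by simp [eq_comm]⟩
    | cons a l ih =>
      intro l' c
      obtain ⟨c', d, h, h1, h2, h3⟩ := ih l'.tail (if l'.head? = some a then c else a :: c)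
      refine ⟨c', d, Runs.mono (runs_loop_step (a := a) (l := l) (n := 2) rfl rfl ?_ h)
        (by simp; omega), ?_, h2.trans (by simp), ?_⟩
      · refine runs_case (n := 1) ?_
        by_cases hl : l'.head? = some a
        · simpa [hl] using runs_skip _
        · simpa [hl] using runs_push 2 a ![m, l, c, l'.tail]
      · split_ifs at h1 <;> simp at h1 ⊢ <;> omega
      · rw [h3]
        cases l' with
        | nil => simp
        | cons b l' =>
          by_cases hb : b = a
          · simp [hb]
          · simp [hb, Ne.symm hb]
  obtain ⟨c', d, h, h1, h2, h3⟩ := key l l' []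
  refine ⟨d.reverse ++ c', Runs.mono (h.seq (s'' := _) (n' := 2 * d.length + 1) ?_) (by omega),
    ?_, ?_⟩
  · exact runs_pour_three_two d m [] c'
  · simp at h1 ⊢
    omega
  · simp at h3 ⊢
    rw [← h3, and_comm]

/-- Replace the two trees on the top by the truth value of their equality. -/
def eqTrees : StackProg :=
  seq moveTree <| seq (pour 1 2) <| seq moveTree <| seq (pour 2 3) <| seq compareStacks <|
    case 2 fun o =>
      match o with
      | none => pushList 0 (ofBool true).code
      | some _ => seq (clear 2) (pushList 0 (ofBool false).code)

theorem runs_eqTrees (a b : BinTree) (m : List Γ') :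
    Runs eqTrees (mainStack (a.code ++ (b.code ++ m)))
      (mainStack ((ofBool (decide (a = b))).code ++ m)) (20 * a.size + 20 * b.size + 20) := by
  have h1 := runs_moveTree a (b.code ++ m) [] []
  have h2 := runs_pour_one_two a.code.reverse (b.code ++ m) [] []
  have h3 := runs_moveTree b m [] a.code
  have h4 := runs_pour_two_three a.code m b.code.reverse []
  obtain ⟨c, h5, hc, hab⟩ := runs_compareStacks b.code.reverse a.code.reverse m
  simp only [List.append_nil, List.reverse_reverse, List.length_reverse, length_code]
    at h1 h2 h3 h4 h5 hc
  rw [List.reverse_inj, code_injective.eq_iff] at hab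
  refine Runs.mono (h1.seq (h2.seq (h3.seq (h4.seq (h5.seq (runs_case (s' := _)
    (n := 2 * c.length + 6) ?_)))))) (by omega)
  cases c with
  | nil =>
    have := hab.1 rfl
    simpa [this, code, ofBool] using
      Runs.mono (runs_pushList 0 (ofBool true).code ![m, [], [], []]) (n' := 6)
        (by simp [code, ofBool])
  | cons x c =>
    have : ¬ a = b := fun h => by simpa using hab.2 h.symm
    have h6 := (runs_clear (k := 2) c ![m, [], c, []] rfl).seq
      (runs_pushList 0 (ofBool false).code _)
    simpa [this, code, ofBool] using Runs.mono h6 (n' := 2 * (x :: c).length + 6)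
      (by simp [code, ofBool]; omega)

end StackProg

section

open StackProg BinTree Computability

/-! ### Functions that are computable in polynomial time -/

/-- Types whose elements are coded by binary trees. -/
class TreeCode (α : Type) where
  /-- the tree that stands for an element -/
  tree : α → BinTree
  tree_injective : Function.Injective tree

open TreeCode (tree tree_injective)

namespace TreeCode

instance : TreeCode BinTree := ⟨id, Function.injective_id⟩

instance : TreeCode Bool := ⟨ofBool, by intro a b; cases a <;> cases b <;> simp [ofBool]⟩

/-- The tree of a natural number in unary. -/
def natTree : ℕ → BinTree
  | 0 => nil
  | n + 1 => cons nil (natTree n)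

instance : TreeCode ℕ where
  tree := natTree
  tree_injective := by
    intro m n
    induction m generalizing n with
    | zero => cases n <;> simp [natTree]
    | succ m ih =>
      cases n with
      | zero => simp [natTree]
      | succ n => simpa [natTree] using @ih n

variable {α β : Type} [TreeCode α] [TreeCode β]

instance : TreeCode (α × β) where
  tree x := cons (tree x.1) (tree x.2)
  tree_injective := by
    rintro ⟨a, b⟩ ⟨a', b'⟩ h
    simpa [tree_injective.eq_iff] using h

/-- The tree of a list. -/
def listTree : List α → BinTree
  | [] => nil
  | a :: l => cons (tree a) (listTree l)

instance : TreeCode (List α) where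
  tree := listTree
  tree_injective := by
    intro l l'
    induction l generalizing l' with
    | nil => cases l' <;> simp [listTree]
    | cons a l ih =>
      cases l' with
      | nil => simp [listTree]
      | cons b l' =>
        simp only [listTree, BinTree.cons.injEq, List.cons.injEq, tree_injective.eq_iff]
        exact fun h => ⟨h.1, ih h.2⟩

/-- Coding an option as a list of length at most one makes `head?` cheap: only the right subtree of
the list has to be replaced by `nil`. -/
instance : TreeCode (Option α) where
  tree o := listTree o.toList
  tree_injective := by
    intro a b
    cases a <;> cases b <;> simp [listTree, tree_injective.eq_iff]

end TreeCode

section polyTime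

variable {α β γ δ : Type} [TreeCode α] [TreeCode β] [TreeCode γ] [TreeCode δ]

/-- The size of the tree that stands for an element. -/
def treeSize (a : α) : ℕ := (tree a).size

@[simp] theorem tree_mk (a : α) (b : β) : tree (a, b) = cons (tree a) (tree b) := rfl

@[simp] theorem tree_list_nil : tree ([] : List α) = nil := rfl

@[simp] theorem tree_list_cons (a : α) (l : List α) : tree (a :: l) = cons (tree a) (tree l) := rfl

@[simp] theorem tree_true : tree true = cons nil nil := rfl

@[simp] theorem tree_false : tree false = nil := rfl

@[simp] theorem tree_nat_zero : tree 0 = nil := rfl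

@[simp] theorem tree_nat_succ (n : ℕ) : tree (n + 1) = cons nil (tree n) := rfl

@[simp] theorem tree_none : tree (none : Option α) = nil := rfl

@[simp] theorem tree_some (a : α) : tree (some a) = cons (tree a) nil := rfl

@[simp] theorem tree_binTree (a : BinTree) : tree a = a := rfl

@[simp] theorem treeSize_mk (a : α) (b : β) :
    treeSize (a, b) = treeSize a + treeSize b + 1 := by simp [treeSize]

@[simp] theorem treeSize_nil : treeSize ([] : List α) = 1 := rfl

@[simp] theorem treeSize_cons (a : α) (l : List α) :
    treeSize (a :: l) = treeSize a + treeSize l + 1 := by simp [treeSize]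

@[simp] theorem treeSize_nat (n : ℕ) : treeSize n = 2 * n + 1 := by
  induction n with
  | zero => rfl
  | succ n ih => simp [treeSize] at ih ⊢; omega

theorem treeSize_bool_le (b : Bool) : treeSize b ≤ 3 := by cases b <;> decide

theorem treeSize_pos (a : α) : 0 < treeSize a := size_pos _

theorem length_le_treeSize (l : List α) : l.length ≤ treeSize l := by
  induction l with
  | nil => simp
  | cons a l ih => simp; omega

theorem treeSize_append (l l' : List α) :
    treeSize (l ++ l') + 1 = treeSize l + treeSize l' := by
  induction l with
  | nil => simp; omega
  | cons a l ih => simp; omega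

theorem treeSize_le_of_mem {a : α} {l : List α} (h : a ∈ l) : treeSize a ≤ treeSize l := by
  obtain ⟨l₁, l₂, rfl⟩ := List.append_of_mem h
  have := treeSize_append l₁ (a :: l₂)
  have := treeSize_pos l₁
  have := treeSize_pos l₂
  simp at *
  omega

theorem treeSize_le_of_sublist {l l' : List α} (h : l.Sublist l') : treeSize l ≤ treeSize l' := by
  induction h <;> simp <;> omega

/-- A function on a type is bounded by a polynomial in the size of the argument. -/
def PolyBounded (B : α → ℕ) : Prop := ∃ P : Polynomial ℕ, ∀ a, B a ≤ P.eval (treeSize a)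

/-- The coefficients are natural numbers. Monotonicity is what allows polynomial bounds to be
composed. -/
theorem Polynomial.eval_nat_mono (P : Polynomial ℕ) : Monotone fun n : ℕ => P.eval n := by
  intro m n h
  simp only [Polynomial.eval_eq_sum, Polynomial.sum]
  gcongr

namespace PolyBounded

variable {B B' : α → ℕ}

theorem mono (h : PolyBounded B) (hB : ∀ a, B' a ≤ B a) : PolyBounded B' :=
  let ⟨P, hP⟩ := h
  ⟨P, fun a => (hB a).trans (hP a)⟩

theorem const (n : ℕ) : PolyBounded fun _ : α => n := ⟨Polynomial.C n, fun _ => by simp⟩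

theorem size : PolyBounded fun a : α => treeSize a := ⟨Polynomial.X, fun _ => by simp⟩

theorem add (h : PolyBounded B) (h' : PolyBounded B') : PolyBounded fun a => B a + B' a :=
  let ⟨P, hP⟩ := h
  let ⟨P', hP'⟩ := h'
  ⟨P + P', fun a => by simpa using Nat.add_le_add (hP a) (hP' a)⟩

theorem mul (h : PolyBounded B) (h' : PolyBounded B') : PolyBounded fun a => B a * B' a :=
  let ⟨P, hP⟩ := h
  let ⟨P', hP'⟩ := h'
  ⟨P * P', fun a => by simpa using Nat.mul_le_mul (hP a) (hP' a)⟩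

theorem eval (P : Polynomial ℕ) (h : PolyBounded B) : PolyBounded fun a => P.eval (B a) :=
  let ⟨Q, hQ⟩ := h
  ⟨P.comp Q, fun a => by simpa using P.eval_nat_mono (hQ a)⟩

theorem comp {B : β → ℕ} {f : α → β} (h : PolyBounded B)
    (hf : PolyBounded fun a => treeSize (f a)) : PolyBounded fun a => B (f a) :=
  let ⟨P, hP⟩ := h
  (hf.eval P).mono fun a => hP (f a)

end PolyBounded

/-- A function is computed in polynomial time by a program that replaces the tree of the argument
on the top of stack `0` by the tree of the value. -/
structure PolyTime (f : α → β) : Prop where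
  bounded : PolyBounded fun a => treeSize (f a)
  runs : ∃ (p : StackProg) (B : α → ℕ), PolyBounded B ∧ ∀ a m,
    Runs p (mainStack ((tree a).code ++ m)) (mainStack ((tree (f a)).code ++ m)) (B a)

namespace PolyTime

/-- Programs see only trees, so the same program serves for `g`. This transfers computability
between types that share codes, such as nonempty lists and pairs. -/
theorem of_tree_eq {f : α → β} (hf : PolyTime f) {g : α → γ} (h : ∀ a, tree (g a) = tree (f a)) :
    PolyTime g := by
  obtain ⟨h1, p, B, hB, h2⟩ := hf
  exact ⟨by simpa [treeSize, h] using h1, p, B, hB, by simpa [h] using h2⟩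

protected theorem id : PolyTime fun a : α => a :=
  ⟨.size, skip, _, .const 1, fun _ _ => runs_skip _⟩

theorem comp {g : β → γ} {f : α → β} (hg : PolyTime g) (hf : PolyTime f) :
    PolyTime fun a => g (f a) := by
  obtain ⟨h1, p, B, hB, h2⟩ := hf
  obtain ⟨h1', q, B', hB', h2'⟩ := hg
  exact ⟨h1'.comp h1, seq p q, _, hB.add (hB'.comp h1), fun a m => (h2 a m).seq (h2' (f a) m)⟩

protected theorem const (b : β) : PolyTime fun _ : α => b := by
  refine ⟨.const _, seq dropTree (pushList 0 (tree b).code), _,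
    (((PolyBounded.const 7).mul .size).add (.const 3)).add (.const ((tree b).code.length + 1)),
    fun a m => ?_⟩
  exact (runs_dropTree (tree a) m).seq (by simpa using runs_pushList 0 (tree b).code (mainStack m))

theorem right : PolyTime BinTree.right := by
  refine ⟨PolyBounded.size.mono fun a => ?_,
    case 0 fun o => if o = some (Γ'.bit true) then dropTree else push 0 (Γ'.bit false),
    _, ((PolyBounded.const 7).mul .size).add (.const 10), fun a m => ?_⟩
  · cases a <;> simp [treeSize, BinTree.right]; omega
  · cases a with
    | nil =>
      refine (runs_case (n := 1) ?_).mono (by omega)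
      simpa [code, BinTree.right] using runs_push 0 (Γ'.bit false) (mainStack m)
    | cons a b =>
      refine (runs_case (n := 7 * a.size + 3) ?_).mono (by simp [treeSize]; omega)
      simpa [code, BinTree.right] using runs_dropTree a (b.code ++ m)

theorem left : PolyTime BinTree.left := by
  refine ⟨PolyBounded.size.mono fun a => ?_,
    case 0 fun o => if o = some (Γ'.bit true) then seq swapTrees dropTree
      else push 0 (Γ'.bit false),
    _, ((PolyBounded.const 18).mul .size).add (.const 20), fun a m => ?_⟩
  · cases a <;> simp [treeSize, BinTree.left]; omega
  · cases a with
    | nil =>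
      refine (runs_case (n := 1) ?_).mono (by omega)
      simpa [code, BinTree.left] using runs_push 0 (Γ'.bit false) (mainStack m)
    | cons a b =>
      refine (runs_case (n := (11 * a.size + 7 * b.size + 7) + (7 * b.size + 3)) ?_).mono
        (by simp [treeSize]; omega)
      simpa [code, BinTree.left] using (runs_swapTrees a b m).seq (runs_dropTree b (a.code ++ m))

theorem toTree {f : α → β} (hf : PolyTime f) : PolyTime fun a => tree (f a) :=
  hf.of_tree_eq fun _ => rfl

theorem fst {f : α → β × γ} (hf : PolyTime f) : PolyTime fun a => (f a).1 :=
  (left.comp hf.toTree).of_tree_eq fun _ => rfl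

theorem snd {f : α → β × γ} (hf : PolyTime f) : PolyTime fun a => (f a).2 :=
  (right.comp hf.toTree).of_tree_eq fun _ => rfl

/-- The argument is duplicated, `g` is applied to the upper copy, and after a swap `f` is applied to
the other one. A single `bit true` on top then turns the two adjacent codes into the code of the
pair. -/
theorem pair {f : α → β} {g : α → γ} (hf : PolyTime f) (hg : PolyTime g) :
    PolyTime fun a => (f a, g a) := by
  obtain ⟨h1, p, B, hB, h2⟩ := hf
  obtain ⟨h1', q, B', hB', h2'⟩ := hg
  refine ⟨((h1.add h1').add (.const 1)).mono fun a => by simp,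
    seq dupTree (seq q (seq swapTrees (seq p (push 0 (Γ'.bit true))))), _,
    (((PolyBounded.const 12).mul .size).add (.const 5)).add (hB'.add
      (((((PolyBounded.const 11).mul h1').add ((PolyBounded.const 7).mul .size)).add
        (.const 7)).add (hB.add (.const 1)))), fun a m => ?_⟩
  refine (runs_dupTree (tree a) m).seq ((h2' a _).seq ((runs_swapTrees (tree (g a)) (tree a) m).seq
    ((h2 a _).seq ?_)))
  simpa [code] using runs_push 0 (Γ'.bit true)
    (mainStack ((tree (f a)).code ++ ((tree (g a)).code ++ m)))

protected theorem ite {c : α → Bool} {f g : α → β} (hc : PolyTime c) (hf : PolyTime f)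
    (hg : PolyTime g) : PolyTime fun a => if c a then f a else g a := by
  obtain ⟨-, r, C, hC, h2c⟩ := hc
  obtain ⟨h1, p, B, hB, h2⟩ := hf
  obtain ⟨h1', q, B', hB', h2'⟩ := hg
  refine ⟨(h1.add h1').mono fun a => by split_ifs <;> omega,
    seq dupTree (seq r (case 0 fun o => if o = some (Γ'.bit true) then
      case 0 fun _ => case 0 fun _ => p else q)), _,
    (((PolyBounded.const 12).mul .size).add (.const 5)).add (hC.add ((hB.add hB').add (.const 3))),
    fun a m => ?_⟩
  refine (runs_dupTree (tree a) m).seq ((h2c a _).seq ?_)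
  cases hca : c a with
  | false =>
    refine (runs_case (n := B' a) ?_).mono (by omega)
    simpa [code] using h2' a m
  | true =>
    refine (runs_case (n := B a + 2) ?_).mono (by omega)
    -- The code of `true` has three symbols; two of them are still to be popped after the test.
    simp only [tree_true, code, List.cons_append, List.nil_append, Matrix.cons_val_zero,
      List.head?_cons, if_true, List.tail_cons, update_store_zero]
    refine runs_case (n := B a + 1) (runs_case (n := B a) ?_)
    simpa using h2 a m

protected theorem eq [DecidableEq β] {f g : α → β} (hf : PolyTime f) (hg : PolyTime g) :
    PolyTime fun a => decide (f a = g a) := by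
  have key : PolyTime fun z : β × β => decide (z.1 = z.2) := by
    -- Popping the leading bit of a pair leaves the codes of its components, ready for `eqTrees`.
    refine ⟨(PolyBounded.const 3).mono fun a => treeSize_bool_le _,
      case 0 fun _ => eqTrees, _, ((PolyBounded.const 20).mul .size).add (.const 21),
      fun a m => ?_⟩
    obtain ⟨b, b'⟩ := a
    refine (runs_case (n := 20 * (tree b).size + 20 * (tree b').size + 20) ?_).mono
      (by simp [treeSize]; omega)
    have h : tree (decide (b = b')) = ofBool (decide (tree b = tree b')) := by
      simp only [tree_injective.eq_iff]
      rfl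
    rw [h]
    simpa [code] using runs_eqTrees (tree b) (tree b') m
  exact key.comp (hf.pair hg)

end PolyTime

/-- The body of a loop over a list that keeps a state: `p` turns the pair of the list and the
state to the pair of the tail and the new state. -/
def StackProg.foldLoop (p : StackProg) : StackProg :=
  loop 0 (fun a => a = Γ'.bit false) fun a =>
    seq (push 0 a) (seq (push 0 a) (seq p (case 0 fun _ => skip)))

/-- A nonempty list has the same code as the pair of its head and tail. With its leading bit popped
and then pushed twice, the stack starts with the code of `((a, l), b)`, the input of `p`; the final
pop splits the resulting pair into list and state again. A popped `bit false` is the empty list, and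
leaves just the state. `T` has to bound the cost of `p` only on states that occur. -/
theorem StackProg.runs_foldLoop {p : StackProg} {f : β → α → β} {B : (α × List α) × β → ℕ}
    (hp : ∀ (z : (α × List α) × β) (m), Runs p (mainStack ((tree z).code ++ m))
      (mainStack ((tree (z.1.2, f z.2 z.1.1)).code ++ m)) (B z))
    (l : List α) (b : β) (m : List Γ') (T : ℕ)
    (hT : ∀ l₁ a l₂, l = l₁ ++ a :: l₂ → B ((a, l₂), l₁.foldl f b) ≤ T) :
    Runs (foldLoop p) (mainStack ((tree l).code ++ ((tree b).code ++ m)))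
      (mainStack ((tree (l.foldl f b)).code ++ m)) (l.length * (T + 5) + 1) := by
  induction l generalizing b with
  | nil =>
    refine Runs.mono ?_ (Nat.le_add_left _ _)
    simpa [foldLoop, code] using runs_loop_exit (k := 0) (exits := fun a => a = Γ'.bit false)
      (f := fun a => seq (push 0 a) (seq (push 0 a) (seq p (case 0 fun _ => skip))))
      (s := mainStack (Γ'.bit false :: ((tree b).code ++ m))) rfl rfl
  | cons a l ih =>
    have h1 := ih (f b a) fun l₁ a' l₂ h => hT (a :: l₁) a' l₂ (by simp [h])
    have h2 := (hp ((a, l), b) m).mono (hT [] a l rfl)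
    have h3 : Runs (case 0 fun _ => skip) (mainStack ((tree (l, f b a)).code ++ m))
        (mainStack ((tree l).code ++ ((tree (f b a)).code ++ m))) 2 :=
      runs_case (n := 1) (by simpa [code] using runs_skip _)
    have h4 : Runs (seq (push 0 (Γ'.bit true)) (seq (push 0 (Γ'.bit true))
        (seq p (case 0 fun _ => skip))))
        (mainStack ((tree a).code ++ ((tree l).code ++ ((tree b).code ++ m))))
        (mainStack ((tree l).code ++ ((tree (f b a)).code ++ m))) (1 + (1 + (T + 2))) := by
      refine (runs_push _ _ _).seq ((runs_push _ _ _).seq ((h2.seq h3).cast ?_))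
      simp [code]
    refine Runs.mono (runs_loop_step (s := mainStack ((tree (a :: l)).code ++ ((tree b).code ++ m)))
      (a := Γ'.bit true) rfl rfl (h4.cast ?_) h1) (by simp; ring_nf; omega)
    simp [code]
    rfl

/-! ### Folds over lists in polynomial time -/

namespace PolyTime

/-- Iterating a polynomial-time step can blow up the state exponentially, so a polynomial bound on
all intermediate states is required. -/
theorem foldl_of_bounded {l : δ → List α} {i : δ → β} {f : β → α → β} {B : δ → ℕ}
    (hl : PolyTime l) (hi : PolyTime i) (hf : PolyTime fun z : β × α => f z.1 z.2)
    (hB : PolyBounded B)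
    (h : ∀ x l₁ l₂, l x = l₁ ++ l₂ → treeSize (l₁.foldl f (i x)) ≤ B x) :
    PolyTime fun x => (l x).foldl f (i x) := by
  have hz : PolyTime fun z : (α × List α) × β => z := PolyTime.id
  obtain ⟨-, p, C, ⟨P, hP⟩, hp⟩ := hz.fst.snd.pair (hf.comp (hz.snd.pair hz.fst.fst))
  obtain ⟨h1, q, D, hD, hq⟩ := hl.pair hi
  have hT := ((hl.bounded.add hB).add (.const 1)).eval P
  refine ⟨hB.mono fun x => h x (l x) [] (by simp), seq q (case 0 fun _ => foldLoop p), _,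
    hD.add (((hl.bounded.mul (hT.add (.const 5))).add (.const 1)).add (.const 1)), fun x m => ?_⟩
  refine (hq x m).seq (runs_case ?_)
  refine Runs.mono (n := (l x).length * (P.eval (treeSize (l x) + B x + 1) + 5) + 1) ?_
    (by gcongr; exact length_le_treeSize _)
  simpa [code] using runs_foldLoop hp (l x) (i x) m (P.eval (treeSize (l x) + B x + 1))
    fun l₁ a l₂ hla => (hP _).trans <| P.eval_nat_mono <| by
      have h2 := h x l₁ (a :: l₂) hla
      have h3 : treeSize (a :: l₂) ≤ treeSize (l x) :=
        treeSize_le_of_sublist (by rw [hla]; exact List.sublist_append_right _ _)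
      simp at h3 ⊢
      omega

/-- If each step adds at most `Q x` to the size, the states stay below the initial size plus `Q x`
times the number of steps. The parameter `x` is carried along as part of the state. -/
theorem foldl {l : δ → List α} {i : δ → β} {f : δ → β → α → β} {Q : δ → ℕ}
    (hl : PolyTime l) (hi : PolyTime i) (hf : PolyTime fun z : δ × β × α => f z.1 z.2.1 z.2.2)
    (hQ : PolyBounded Q)
    (h : ∀ x b, ∀ a ∈ l x, treeSize (f x b a) ≤ treeSize b + Q x) :
    PolyTime fun x => (l x).foldl (f x) (i x) := by
  have hx : PolyTime fun x : δ => x := PolyTime.id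
  have hz : PolyTime fun z : (δ × β) × α => z := PolyTime.id
  have hpair : ∀ x (l : List α) b,
      l.foldl (fun (z : δ × β) a => (z.1, f z.1 z.2 a)) (x, b) = (x, l.foldl (f x) b) := by
    intro x l
    induction l with
    | nil => simp
    | cons a l ih => simp [ih]
  have hsize : ∀ x l₁ l₂, l x = l₁ ++ l₂ →
      treeSize (l₁.foldl (f x) (i x)) ≤ treeSize (i x) + l₁.length * Q x := by
    intro x l₁
    induction l₁ using List.reverseRecOn with
    | nil => simp
    | append_singleton l₁ a ih =>
      intro l₂ hl
      have h1 := ih (a :: l₂) (by simp [hl])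
      have h2 := h x (l₁.foldl (f x) (i x)) a (by simp [hl])
      rw [List.foldl_append, List.length_append]
      simp only [List.foldl_cons, List.foldl_nil, List.length_cons, List.length_nil]
      linarith
  have key := foldl_of_bounded (f := fun (z : δ × β) a => (z.1, f z.1 z.2 a))
    (B := fun x => treeSize x + (treeSize (i x) + treeSize (l x) * Q x) + 1) hl (hx.pair hi)
    (hz.fst.fst.pair (hf.comp (hz.fst.fst.pair (hz.fst.snd.pair hz.snd))))
    ((PolyBounded.size.add (hi.bounded.add (hl.bounded.mul hQ))).add (.const 1)) (by
      intro x l₁ l₂ hl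
      rw [hpair, treeSize_mk]
      gcongr
      refine (hsize x l₁ l₂ hl).trans ?_
      gcongr
      refine le_trans ?_ (length_le_treeSize _)
      simp [hl])
  simpa only [hpair] using key.snd

end PolyTime

namespace PolyTime

/-! ### Truth values -/

theorem and {f g : α → Bool} (hf : PolyTime f) (hg : PolyTime g) :
    PolyTime fun a => f a && g a :=
  (hf.ite hg (.const false)).of_tree_eq fun a => by cases f a <;> rfl

theorem or {f g : α → Bool} (hf : PolyTime f) (hg : PolyTime g) :
    PolyTime fun a => f a || g a :=
  (hf.ite (.const true) hg).of_tree_eq fun a => by cases f a <;> rfl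

/-! ### Lists -/

theorem cons {f : α → β} {g : α → List β} (hf : PolyTime f) (hg : PolyTime g) :
    PolyTime fun a => f a :: g a :=
  (hf.pair hg).of_tree_eq fun _ => rfl

theorem tail {f : α → List β} (hf : PolyTime f) : PolyTime fun a => (f a).tail :=
  (right.comp hf.toTree).of_tree_eq fun a => by cases f a <;> rfl

theorem head? {f : α → List β} (hf : PolyTime f) : PolyTime fun a => (f a).head? :=
  ((hf.toTree.eq (.const nil)).ite (.const nil)
    (((left.comp hf.toTree).pair (.const nil)).of_tree_eq (g := fun a =>
      BinTree.cons (BinTree.left (tree (f a))) nil) fun _ => rfl)).of_tree_eq fun a => by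
      cases f a <;> simp [BinTree.left]

theorem reverse {f : α → List β} (hf : PolyTime f) : PolyTime fun a => (f a).reverse := by
  have hz : PolyTime fun z : α × List β × β => z := PolyTime.id
  refine (hf.foldl (i := fun _ => []) (f := fun _ b a => a :: b) (.const _)
    (hz.snd.snd.cons hz.snd.fst) (hf.bounded.add (.const 1)) ?_).of_tree_eq fun a => by simp
  intro x b a ha
  have := treeSize_le_of_mem ha
  simp
  omega

theorem append {f g : α → List β} (hf : PolyTime f) (hg : PolyTime g) :
    PolyTime fun a => f a ++ g a := by
  have hz : PolyTime fun z : α × List β × β => z := PolyTime.id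
  refine (hf.reverse.foldl (i := g) (f := fun _ b a => a :: b) hg
    (hz.snd.snd.cons hz.snd.fst) (hf.bounded.add (.const 1)) ?_).of_tree_eq fun a => by simp
  intro x b a ha
  have := treeSize_le_of_mem (List.mem_reverse.1 ha)
  simp
  omega

theorem flatMap {l : δ → List α} {f : δ → α → List β} (hl : PolyTime l)
    (hf : PolyTime fun z : δ × α => f z.1 z.2) : PolyTime fun x => (l x).flatMap (f x) := by
  have hz : PolyTime fun z : δ × List β × α => z := PolyTime.id
  obtain ⟨P, hP⟩ := hf.bounded
  refine (hl.foldl (i := fun _ => []) (f := fun x b a => b ++ f x a) (.const _)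
    (hz.snd.fst.append (hf.comp (hz.fst.pair hz.snd.snd)))
    (((PolyBounded.size.add hl.bounded).add (.const 1)).eval P) ?_).of_tree_eq fun x => by
      rw [List.foldl_append_eq_append]
      rfl
  intro x b a ha
  have h1 := treeSize_append b (f x a)
  have h2 := (hP (x, a)).trans (P.eval_nat_mono (b := treeSize x + treeSize (l x) + 1) (by
    have := treeSize_le_of_mem ha
    simp; omega))
  simp only at h2
  omega

theorem map {l : δ → List α} {f : δ → α → β} (hl : PolyTime l)
    (hf : PolyTime fun z : δ × α => f z.1 z.2) : PolyTime fun x => (l x).map (f x) :=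
  (hl.flatMap (f := fun x a => [f x a]) (hf.cons (.const []))).of_tree_eq fun x => by
    rw [List.map_eq_flatMap]

theorem filter {l : δ → List α} {p : δ → α → Bool} (hl : PolyTime l)
    (hp : PolyTime fun z : δ × α => p z.1 z.2) : PolyTime fun x => (l x).filter (p x) :=
  (hl.flatMap (f := fun x a => if p x a then [a] else [])
    (hp.ite (PolyTime.id.snd.cons (.const [])) (.const []))).of_tree_eq fun x => by
      congr 1
      induction l x with
      | nil => rfl
      | cons a l ih =>
        rw [List.filter_cons, List.flatMap_cons, ih]
        split_ifs <;> simp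

theorem any {l : δ → List α} {p : δ → α → Bool} (hl : PolyTime l)
    (hp : PolyTime fun z : δ × α => p z.1 z.2) : PolyTime fun x => (l x).any (p x) := by
  have hz : PolyTime fun z : δ × Bool × α => z := PolyTime.id
  refine (hl.foldl (i := fun _ => false) (f := fun x b a => b || p x a) (.const _)
    (hz.snd.fst.or (hp.comp (hz.fst.pair hz.snd.snd))) (.const 3) ?_).of_tree_eq fun x => ?_
  · intro x b a ha
    have := treeSize_bool_le (b || p x a)
    omega
  · congr 1
    have : ∀ (l : List α) (b : Bool), l.foldl (fun b a => b || p x a) b = (b || l.any (p x)) := by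
      intro l
      induction l with
      | nil => simp
      | cons a l ih => simp [ih, Bool.or_assoc]
    simp [this]

theorem product {l : δ → List α} {l' : δ → List β} (hl : PolyTime l) (hl' : PolyTime l') :
    PolyTime fun x => l x ×ˢ l' x :=
  hl.flatMap (f := fun x a => (l' x).map (Prod.mk a))
    ((hl'.comp PolyTime.id.fst).map (f := fun (z : δ × α) b => (z.2, b))
      (PolyTime.id.fst.snd.pair PolyTime.id.snd))

/-! ### Natural numbers in unary -/

theorem succ {f : α → ℕ} (hf : PolyTime f) : PolyTime fun a => f a + 1 :=
  ((PolyTime.const nil).pair hf).of_tree_eq fun _ => rfl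

theorem pred {f : α → ℕ} (hf : PolyTime f) : PolyTime fun a => f a - 1 :=
  (right.comp hf.toTree).of_tree_eq fun a => by cases f a <;> rfl

theorem length {f : α → List β} (hf : PolyTime f) : PolyTime fun a => (f a).length := by
  have hz : PolyTime fun z : α × ℕ × β => z := PolyTime.id
  exact (hf.foldl (i := fun _ => 0) (f := fun _ n _ => n + 1) (.const _)
    hz.snd.fst.succ (.const 2) fun _ b _ _ => by simp; omega).of_tree_eq fun a => by simp

/-- This identifies unary numbers with lists, so that appending is addition and a number can control
a fold. -/
theorem _root_.tree_replicate (n : ℕ) : tree (List.replicate n nil) = tree n := by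
  induction n with
  | zero => rfl
  | succ n ih => simp [List.replicate_succ, ih]

theorem replicate {f : α → ℕ} (hf : PolyTime f) : PolyTime fun a => List.replicate (f a) nil :=
  hf.of_tree_eq fun _ => tree_replicate _

theorem add {f g : α → ℕ} (hf : PolyTime f) (hg : PolyTime g) : PolyTime fun a => f a + g a :=
  (hf.replicate.append hg.replicate).of_tree_eq fun a => by
    rw [List.replicate_append_replicate, tree_replicate]

theorem sub {f g : α → ℕ} (hf : PolyTime f) (hg : PolyTime g) : PolyTime fun a => f a - g a := by
  have hz : PolyTime fun z : α × ℕ × BinTree => z := PolyTime.id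
  refine (hg.replicate.foldl (i := f) (f := fun _ n _ => n - 1) hf hz.snd.fst.pred (.const 0)
    fun _ b _ _ => by simp).of_tree_eq fun a => ?_
  congr 1
  generalize f a = m
  induction g a generalizing m with
  | zero => rfl
  | succ n ih =>
    rw [List.replicate_succ, List.foldl_cons, ← ih]
    omega

theorem le {f g : α → ℕ} (hf : PolyTime f) (hg : PolyTime g) :
    PolyTime fun a => decide (f a ≤ g a) :=
  ((hf.sub hg).eq (.const 0)).of_tree_eq fun a => by simp [Nat.sub_eq_zero_iff_le]

theorem min {f g : α → ℕ} (hf : PolyTime f) (hg : PolyTime g) :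
    PolyTime fun a => Min.min (f a) (g a) :=
  ((hf.le hg).ite hf hg).of_tree_eq fun a => by simp [min_def]

/-- Here `c` is fixed and the program consists of repeated additions. It is used for the points of
the scoring rule, which are not part of the input. -/
theorem const_mul (c : ℕ) {f : α → ℕ} (hf : PolyTime f) : PolyTime fun a => c * f a := by
  induction c with
  | zero => simpa using PolyTime.const 0
  | succ c ih => simpa [Nat.add_mul] using ih.add hf

theorem _root_.treeSize_range_le (n : ℕ) : treeSize (List.range n) ≤ n * (2 * n + 2) + 1 := by
  have h : ∀ (l : List ℕ), (∀ i ∈ l, i ≤ n) → treeSize l ≤ l.length * (2 * n + 2) + 1 := by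
    intro l hl
    induction l with
    | nil => simp
    | cons a l ih =>
      have := ih fun i hi => hl i (by simp [hi])
      have := hl a (by simp)
      simp only [treeSize_cons, treeSize_nat, List.length_cons, Nat.add_mul]
      omega
  simpa using h (List.range n) fun i hi => by have := List.mem_range.1 hi; omega

/-- Each step shifts all entries and prepends `0`. The growth of a step depends on the state, so
`foldl_of_bounded` is used with the explicit value `key` of the partial folds. -/
theorem range {f : α → ℕ} (hf : PolyTime f) : PolyTime fun a => List.range (f a) := by
  have hz : PolyTime fun z : List ℕ × BinTree => z := PolyTime.id
  have key : ∀ n : ℕ, (List.replicate n nil).foldl (fun l _ => 0 :: l.map (· + 1)) [] =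
      List.range n := by
    intro n
    induction n with
    | zero => rfl
    | succ n ih =>
      rw [List.replicate_succ', List.foldl_append, ih, List.range_succ_eq_map]
      rfl
  refine (hf.replicate.foldl_of_bounded (i := fun _ => [])
    (f := fun (l : List ℕ) _ => 0 :: l.map (· + 1))
    (B := fun a => treeSize (f a) * (2 * treeSize (f a) + 2) + 1) (.const _)
    ((PolyTime.const 0).cons (hz.fst.map (f := fun _ n => n + 1) PolyTime.id.snd.succ))
    ((hf.bounded.mul (((PolyBounded.const 2).mul hf.bounded).add (.const 2))).add (.const 1))
    ?_).of_tree_eq fun a => by rw [key]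
  intro a l₁ l₂ h
  obtain ⟨h1, h2, -⟩ := List.replicate_eq_append_iff.1 h
  rw [h2, key]
  refine (treeSize_range_le _).trans ?_
  have : l₁.length ≤ treeSize (f a) := by simp; omega
  gcongr

end PolyTime

theorem PolyTime.optionSome {f : α → β} (hf : PolyTime f) : PolyTime fun a => Option.some (f a) :=
  (hf.pair (.const nil)).of_tree_eq fun _ => rfl

end polyTime

/-! ### From strings to trees -/

namespace TreeCode

/-- The number of a symbol. -/
def symbolIndex : Γ' → ℕ
  | Γ'.blank => 0
  | Γ'.bit false => 1
  | Γ'.bit true => 2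
  | Γ'.bra => 3
  | Γ'.ket => 4
  | Γ'.comma => 5

instance : TreeCode Γ' where
  tree a := tree (symbolIndex a)
  tree_injective := tree_injective.comp (by unfold Function.Injective; decide)

end TreeCode

theorem treeSize_symbol_le (a : Γ') : treeSize a ≤ 11 := by
  have h : treeSize a = treeSize (TreeCode.symbolIndex a) := rfl
  have : TreeCode.symbolIndex a ≤ 5 := by
    revert a
    decide
  rw [h, treeSize_nat]
  omega

theorem treeSize_word_le (w : List Γ') : treeSize w ≤ 12 * w.length + 1 := by
  induction w with
  | nil => simp
  | cons a w ih =>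
    have := treeSize_symbol_le a
    simp
    omega

namespace StackProg

/-- Push the trees of the symbols on stack `2` on the list on stack `0`. -/
def loadLoop : StackProg :=
  loop 2 (fun _ => false) fun a => pushList 0 (Γ'.bit true :: (tree a).code)

theorem runs_loadLoop (l w : List Γ') :
    Runs loadLoop ![(tree w).code, [], l, []] (mainStack (tree (l.reverse ++ w)).code)
      (14 * l.length + 1) := by
  induction l generalizing w with
  | nil => exact runs_loop_empty rfl
  | cons a l ih =>
    have h1 := runs_pushList 0 (Γ'.bit true :: (tree a).code) ![(tree w).code, [], l, []]
    have h2 := runs_loop_step (k := 2) (exits := fun _ => false)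
      (f := fun a => pushList 0 (Γ'.bit true :: (tree a).code))
      (s := ![(tree w).code, [], a :: l, []]) rfl rfl (by simpa using h1)
      (by simpa [loadLoop, code] using ih (a :: w))
    have h3 : (tree a).code.length ≤ 11 := treeSize_symbol_le a
    simpa [loadLoop] using h2.mono (n' := 14 * (a :: l).length + 1) (by simp; omega)

/-- Turn the input to a tree on stack `0`. -/
def load : StackProg := seq (push 0 (Γ'.bit false)) (seq (pour 1 2) loadLoop)

/-- Pouring reverses the input, so that its last symbol is the first to be put on the list. -/
theorem runs_load (w : List Γ') :
    Runs load ![[], w, [], []] (mainStack (tree w).code) (16 * w.length + 3) := by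
  have h1 := runs_push 0 (Γ'.bit false) ![[], w, [], []]
  have h2 := runs_pour_one_two w [Γ'.bit false] [] []
  have h3 := runs_loadLoop w.reverse []
  simp only [List.append_nil, List.reverse_reverse, List.length_reverse] at h2 h3
  exact Runs.mono ((by simpa using h1 : Runs _ _ _ _).seq (h2.seq h3)) (by omega)

end StackProg

/-- A predicate that is computed in polynomial time on the trees of the strings that describe the
instances is solvable in polynomial time. -/
theorem PolyTime.solvableInPolyTime {X : Type} [TreeCode X] (e : Encoding X Γ')
    (he : ∀ x, tree x = tree (e.encode x)) {g : X → Bool} (hg : PolyTime g) {P : X → Prop}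
    (h : ∀ x, g x = true ↔ P x) : SolvableInPolyTime e P := by
  obtain ⟨-, p, B, ⟨Q, hQ⟩, hp⟩ := hg
  refine StackProg.solvableInPolyTime e P
    (seq load (seq p (case 0 fun o => if o = some (Γ'.bit true) then
      seq (clear 0) (push 0 (Γ'.bit true)) else push 0 (Γ'.bit false))))
    ((16 * Polynomial.X + 3) + (Q.comp (12 * Polynomial.X + 1) + 7)) g h fun x => ?_
  have h1 := runs_load (e.encode x)
  have h2 : Runs p (mainStack (tree (e.encode x)).code) (mainStack (tree (g x)).code) (B x) := by
    simpa [he] using hp x []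
  have h3 : B x ≤ Q.eval (12 * (e.encode x).length + 1) := by
    refine (hQ x).trans (Q.eval_nat_mono ?_)
    rw [treeSize, he]
    exact treeSize_word_le _
  -- The tree of the truth value is replaced by a single symbol. For `true` this takes one pop, five
  -- steps to clear two symbols, and one push.
  suffices h4 : Runs (case 0 fun o => if o = some (Γ'.bit true) then
      seq (clear 0) (push 0 (Γ'.bit true)) else push 0 (Γ'.bit false))
      (mainStack (tree (g x)).code) ![[Γ'.bit (g x)], [], [], []] 7 by
    obtain ⟨t, ht, hx⟩ := h1.seq (h2.seq h4)
    refine ⟨t, ht.trans ?_, hx⟩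
    simp
    omega
  cases g x with
  | false =>
    refine (runs_case (n := 1) ?_).mono (by omega)
    simpa [code] using runs_push 0 (Γ'.bit false) (mainStack [])
  | true =>
    refine runs_case (n := 5 + 1) ?_
    have := (runs_clear (k := 0) [Γ'.bit false, Γ'.bit false]
      (mainStack [Γ'.bit false, Γ'.bit false]) rfl).seq (runs_push 0 (Γ'.bit true) _)
    simpa [code] using this

/-! ### Reading an instance -/

/-- Natural numbers in binary. -/
def BinaryNat : Type := ℕ

instance : DecidableEq BinaryNat := inferInstanceAs (DecidableEq ℕ)

theorem encodeNat_injective : Function.Injective encodeNat :=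
  Function.LeftInverse.injective decode_encodeNat

/-- Candidate names are only compared, so they stay in binary; in unary they could be exponentially
long. -/
instance : TreeCode BinaryNat where
  tree n := tree (encodeNat n)
  tree_injective := tree_injective.comp encodeNat_injective

/-- An instance is represented by its string, so that sizes are measured by the input length.
Parsing becomes part of the function to be computed. -/
instance : TreeCode CCAVInstance where
  tree I := tree I.encode
  tree_injective := tree_injective.comp CCAVInstance.encode_injective

namespace CCAVInstance

/-- The parser keeps the bits of a number and, for every open bracket, the list of the trees of
the items that it has read; lists are in reverse order. -/
def parseStep (s : List Bool × List (List BinTree)) (a : Γ') : List Bool × List (List BinTree) :=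
  if a = Γ'.bit true then (true :: s.1, s.2)
  else if a = Γ'.bit false then (false :: s.1, s.2)
  else if a = Γ'.comma then ([], (tree s.1.reverse :: s.2.headD []) :: s.2.tail)
  else if a = Γ'.bra then (s.1, [] :: s.2)
  else if a = Γ'.ket then
    (s.1, (tree (s.2.headD []).reverse :: s.2.tail.headD []) :: s.2.tail.tail)
  else s

theorem parse_number (n : ℕ) (l : List BinTree) (s : List (List BinTree)) :
    (encodeNumber n).foldl parseStep ([], l :: s) = ([], (tree (α := BinaryNat) n :: l) :: s) := by
  have h : ∀ (w : List Bool) (b : List Bool) (s : List (List BinTree)),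
      (w.map Γ'.bit).foldl parseStep (b, s) = (w.reverse ++ b, s) := by
    intro w
    induction w with
    | nil => simp
    | cons x w ih =>
      intro b s
      cases x <;> simp [parseStep, ih]
  rw [encodeNumber, List.foldl_append, h]
  simp [parseStep]
  rfl

/-- The conclusion has the same form as the hypothesis on the items, so the lemma applies first to
votes and then to lists of votes. -/
theorem parse_list {X : Type} [TreeCode X] (enc : X → List Γ')
    (h : ∀ x l s, (enc x).foldl parseStep ([], l :: s) = ([], (tree x :: l) :: s))
    (L : List X) (l : List BinTree) (s : List (List BinTree)) :
    (Γ'.bra :: L.flatMap enc ++ [Γ'.ket]).foldl parseStep ([], l :: s) =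
      ([], (tree L :: l) :: s) := by
  have key : ∀ (L : List X) (l : List BinTree) (s : List (List BinTree)),
      (L.flatMap enc).foldl parseStep ([], l :: s) = ([], ((L.map tree).reverse ++ l) :: s) := by
    intro L
    induction L with
    | nil => simp
    | cons x L ih => simp [h, ih]
  have htree : tree (L.map tree) = tree L := by
    induction L with
    | nil => rfl
    | cons x L ih => simp [ih]
  have hbra : parseStep ([], l :: s) Γ'.bra = ([], [] :: l :: s) := by simp [parseStep]
  rw [List.cons_append, List.foldl_cons, List.foldl_append, hbra, key]
  simp [parseStep, htree]

theorem parse_vote (v : Vote) (l : List BinTree) (s : List (List BinTree)) :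
    (encodeVote v).foldl parseStep ([], l :: s) =
      ([], (tree (α := List BinaryNat) v :: l) :: s) :=
  parse_list (X := BinaryNat) encodeNumber parse_number v l s

theorem parse_votes (V : List Vote) (l : List BinTree) (s : List (List BinTree)) :
    (encodeVotes V).foldl parseStep ([], l :: s) =
      ([], (tree (α := List (List BinaryNat)) V :: l) :: s) :=
  parse_list (X := List BinaryNat) encodeVote parse_vote V l s

theorem parse_encode (I : CCAVInstance) :
    I.encode.foldl parseStep ([], [[]]) = ([], [[tree (α := List (List BinaryNat)) I.U,
      tree (α := List (List BinaryNat)) I.R, tree (α := BinaryNat) I.k, tree (α := BinaryNat) I.p,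
      tree (α := List BinaryNat) I.cands]]) := by
  simp only [encode, List.foldl_append, parse_vote, parse_number, parse_votes]

end CCAVInstance

theorem PolyTime.headD {α β : Type} [TreeCode α] [TreeCode β] {f : α → List (List β)}
    (hf : PolyTime f) : PolyTime fun a => (f a).headD [] :=
  (PolyTime.left.comp hf.toTree).of_tree_eq fun a => by cases f a <;> rfl

theorem treeSize_headD_tail_le {β : Type} [TreeCode β] (l : List (List β)) :
    treeSize (l.headD []) + treeSize l.tail ≤ treeSize l + 1 := by
  cases l <;> simp; omega

theorem treeSize_reverse {β : Type} [TreeCode β] (l : List β) :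
    treeSize l.reverse = treeSize l := by
  induction l with
  | nil => rfl
  | cons a l ih =>
    have := treeSize_append l.reverse [a]
    simp at *
    omega

theorem treeSize_tree {β : Type} [TreeCode β] (b : β) : treeSize (tree b) = treeSize b := rfl

namespace CCAVInstance

theorem polyTime_parse : PolyTime fun I : CCAVInstance =>
    (I.encode.foldl parseStep ([], [[]])).2.headD [] := by
  have henc : PolyTime fun I : CCAVInstance => I.encode := PolyTime.id.of_tree_eq fun _ => rfl
  have hz : PolyTime fun z : CCAVInstance × (List Bool × List (List BinTree)) × Γ' => z :=
    PolyTime.id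
  have ha := hz.snd.snd
  have h1 := hz.snd.fst.fst
  have h2 := hz.snd.fst.snd
  have hstep : PolyTime fun z : CCAVInstance × (List Bool × List (List BinTree)) × Γ' =>
      parseStep z.2.1 z.2.2 := by
    refine ((ha.eq (.const (Γ'.bit true))).ite (((PolyTime.const true).cons h1).pair h2) <|
      (ha.eq (.const (Γ'.bit false))).ite (((PolyTime.const false).cons h1).pair h2) <|
      (ha.eq (.const Γ'.comma)).ite
        ((PolyTime.const []).pair ((h1.reverse.toTree.cons h2.headD).cons h2.tail)) <|
      (ha.eq (.const Γ'.bra)).ite (h1.pair ((PolyTime.const []).cons h2)) <|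
      (ha.eq (.const Γ'.ket)).ite
        (h1.pair ((h2.headD.reverse.toTree.cons h2.tail.headD).cons h2.tail.tail))
        hz.snd.fst).of_tree_eq fun z => ?_
    simp only [decide_eq_true_eq, parseStep]
  -- A symbol only rearranges what has been read and adds boundedly many nodes; 10 is enough.
  refine ((henc.foldl (f := fun _ => parseStep) (.const ([], [[]])) hstep (.const 10)
    fun x s a _ => ?_).snd).headD
  obtain ⟨b, s⟩ := s
  have h3 := treeSize_headD_tail_le s
  have h4 := treeSize_headD_tail_le s.tail
  have h5 := treeSize_pos b
  unfold parseStep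
  split_ifs <;> simp [treeSize_tree, treeSize_reverse] <;>
    simp [treeSize] at * <;> omega

/-- The parser yields the five fields in reverse order, so the first one lies deepest. -/
theorem polyTime_cands : PolyTime (β := List BinaryNat) fun I : CCAVInstance => I.cands :=
  (PolyTime.left.comp (PolyTime.right.comp (PolyTime.right.comp (PolyTime.right.comp
    (PolyTime.right.comp polyTime_parse.toTree))))).of_tree_eq fun I => by
      rw [parse_encode]; rfl

theorem polyTime_p : PolyTime (β := BinaryNat) fun I : CCAVInstance => I.p :=
  (PolyTime.left.comp (PolyTime.right.comp (PolyTime.right.comp (PolyTime.right.comp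
    polyTime_parse.toTree)))).of_tree_eq fun I => by rw [parse_encode]; rfl

/-- Only the bits of `k` are extracted: its unary value may be exponential in the input length. -/
theorem polyTime_k : PolyTime fun I : CCAVInstance => encodeNat I.k :=
  (PolyTime.left.comp (PolyTime.right.comp (PolyTime.right.comp
    polyTime_parse.toTree))).of_tree_eq fun I => by rw [parse_encode]; rfl

theorem polyTime_R : PolyTime (β := List (List BinaryNat)) fun I : CCAVInstance => I.R :=
  (PolyTime.left.comp (PolyTime.right.comp polyTime_parse.toTree)).of_tree_eq fun I => by
    rw [parse_encode]; rfl

theorem polyTime_U : PolyTime (β := List (List BinaryNat)) fun I : CCAVInstance => I.U :=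
  (PolyTime.left.comp polyTime_parse.toTree).of_tree_eq fun I => by rw [parse_encode]; rfl

end CCAVInstance

/-! ### The algorithm -/

namespace AddingVoters

section definitions

variable {N : Type} [DecidableEq N]

/-- The number of votes that rank `c` first. -/
def firstCount (c : N) (V : List (List N)) : ℕ :=
  (V.filter fun v => decide (v.head? = some c)).length

/-- The number of votes that rank `c` second. -/
def secondCount (c : N) (V : List (List N)) : ℕ :=
  (V.filter fun v => decide (v.tail.head? = some c)).length

/-- The number of votes that rank `c` first and `d` second. -/
def pairCount (c d : N) (V : List (List N)) : ℕ :=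
  (V.filter fun v => decide (v.head? = some c) && decide (v.tail.head? = some d)).length

/-- The points of `c` for votes with `a` points for the first and `b` for the second place. -/
def natScore (a b : ℕ) (c : N) (V : List (List N)) : ℕ :=
  a * firstCount c V + b * secondCount c V

/-- Can one choose `s.1` votes that rank `p` first and `c` second and `s.2` votes that rank `c`
first and `p` second, such that `c` does not beat `p` when `q.1` votes with `p` in first place and
`q.2` with `p` in second place are chosen altogether? -/
def admissible (a b : ℕ) (p : N) (R U : List (List N)) (q : ℕ × ℕ) (c : N) (s : ℕ × ℕ) : Bool :=
  decide (s.1 ≤ pairCount p c U) && (decide (s.2 ≤ pairCount c p U) &&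
    decide (natScore a b c R + b * s.1 + a * s.2 ≤ natScore a b p R + a * q.1 + b * q.2))

/-- All pairs of numbers up to `n`. -/
def grid (n : ℕ) : List (ℕ × ℕ) := List.range (n + 1) ×ˢ List.range (n + 1)

/-- The sums of a pair in `T` and a pair in `G` that satisfies `ok`, as far as they lie in `G`. -/
def extend (G : List (ℕ × ℕ)) (ok : ℕ × ℕ → Bool) (T : List (ℕ × ℕ)) : List (ℕ × ℕ) :=
  G.filter fun r => T.any fun t => G.any fun s => ok s && decide ((t.1 + s.1, t.2 + s.2) = r)

/-- The total numbers of votes with `p` in first place and with `p` in second place that can be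
chosen such that nobody beats `p`, if these totals are `q`. -/
def reachable (a b : ℕ) (p : N) (R U : List (List N)) (q : ℕ × ℕ) (C : List N) : List (ℕ × ℕ) :=
  C.foldl (fun T c => extend (grid U.length) (admissible a b p R U q c) T) [(0, 0)]

/-- The decision procedure; `k` is at most the number of votes in `U`. -/
def canWin (a b : ℕ) (C : List N) (p : N) (k : ℕ) (R U : List (List N)) : Bool :=
  (grid U.length).any fun q => decide (q.1 + q.2 ≤ k) &&
    (reachable a b p R U q C).any fun r => decide (r = q)

end definitions

/-- The minimum of `n` and the number with the bits `l`, least significant first. -/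
def boundedValue (n : ℕ) (l : List Bool) : ℕ :=
  l.reverse.foldl (fun m x => min (m + m + if x then 1 else 0) n) 0

/-! ### Its running time -/

section polyTime

variable {N δ : Type} [TreeCode N] [DecidableEq N] [TreeCode δ]

theorem polyTime_firstCount {c : δ → N} {V : δ → List (List N)} (hc : PolyTime c)
    (hV : PolyTime V) : PolyTime fun x => firstCount (c x) (V x) := by
  have hz : PolyTime fun z : δ × List N => z := PolyTime.id
  exact (hV.filter (p := fun x v => decide (v.head? = some (c x)))
    (hz.snd.head?.eq ((hc.comp hz.fst).optionSome))).length

theorem polyTime_secondCount {c : δ → N} {V : δ → List (List N)} (hc : PolyTime c)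
    (hV : PolyTime V) : PolyTime fun x => secondCount (c x) (V x) := by
  have hz : PolyTime fun z : δ × List N => z := PolyTime.id
  exact (hV.filter (p := fun x v => decide (v.tail.head? = some (c x)))
    (hz.snd.tail.head?.eq ((hc.comp hz.fst).optionSome))).length

theorem polyTime_pairCount {c d : δ → N} {V : δ → List (List N)} (hc : PolyTime c)
    (hd : PolyTime d) (hV : PolyTime V) : PolyTime fun x => pairCount (c x) (d x) (V x) := by
  have hz : PolyTime fun z : δ × List N => z := PolyTime.id
  exact (hV.filter
    (p := fun x v => decide (v.head? = some (c x)) && decide (v.tail.head? = some (d x)))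
    ((hz.snd.head?.eq ((hc.comp hz.fst).optionSome)).and
      (hz.snd.tail.head?.eq ((hd.comp hz.fst).optionSome)))).length

theorem polyTime_natScore (a b : ℕ) {c : δ → N} {V : δ → List (List N)} (hc : PolyTime c)
    (hV : PolyTime V) : PolyTime fun x => natScore a b (c x) (V x) :=
  ((polyTime_firstCount hc hV).const_mul a).add ((polyTime_secondCount hc hV).const_mul b)

theorem polyTime_admissible (a b : ℕ) {p c : δ → N} {R U : δ → List (List N)} {q s : δ → ℕ × ℕ}
    (hp : PolyTime p) (hR : PolyTime R) (hU : PolyTime U) (hq : PolyTime q) (hc : PolyTime c)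
    (hs : PolyTime s) : PolyTime fun x => admissible a b (p x) (R x) (U x) (q x) (c x) (s x) :=
  (hs.fst.le (polyTime_pairCount hp hc hU)).and ((hs.snd.le (polyTime_pairCount hc hp hU)).and
    ((((polyTime_natScore a b hc hR).add (hs.fst.const_mul b)).add (hs.snd.const_mul a)).le
      (((polyTime_natScore a b hp hR).add (hq.fst.const_mul a)).add (hq.snd.const_mul b))))

theorem polyTime_grid {n : δ → ℕ} (hn : PolyTime n) : PolyTime fun x => grid (n x) :=
  hn.succ.range.product hn.succ.range

theorem polyTime_extend {G T : δ → List (ℕ × ℕ)} {ok : δ → ℕ × ℕ → Bool} (hG : PolyTime G)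
    (hok : PolyTime fun z : δ × ℕ × ℕ => ok z.1 z.2) (hT : PolyTime T) :
    PolyTime fun x => extend (G x) (ok x) (T x) := by
  have h1 : PolyTime fun z : δ × (ℕ × ℕ) => z := PolyTime.id
  have h2 : PolyTime fun z : (δ × (ℕ × ℕ)) × (ℕ × ℕ) => z := PolyTime.id
  have h3 : PolyTime fun z : ((δ × (ℕ × ℕ)) × (ℕ × ℕ)) × (ℕ × ℕ) => z := PolyTime.id
  exact hG.filter (p := fun x r => (T x).any fun t => (G x).any fun s => ok x s &&
    decide ((t.1 + s.1, t.2 + s.2) = r)) <|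
    (hT.comp h1.fst).any (p := fun z t => (G z.1).any fun s => ok z.1 s &&
      decide ((t.1 + s.1, t.2 + s.2) = z.2)) <|
    (hG.comp h2.fst.fst).any (p := fun z s => ok z.1.1 s &&
      decide ((z.2.1 + s.1, z.2.2 + s.2) = z.1.2)) <|
    (hok.comp (h3.fst.fst.fst.pair h3.snd)).and <|
    ((h3.fst.snd.fst.add h3.snd.fst).pair (h3.fst.snd.snd.add h3.snd.snd)).eq h3.fst.fst.snd

/-- After each step the table is a sublist of the grid, so its size does not grow with the number of
candidates processed. -/
theorem polyTime_reachable (a b : ℕ) {p : δ → N} {R U : δ → List (List N)} {q : δ → ℕ × ℕ}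
    {C : δ → List N} (hp : PolyTime p) (hR : PolyTime R) (hU : PolyTime U) (hq : PolyTime q)
    (hC : PolyTime C) : PolyTime fun x => reachable a b (p x) (R x) (U x) (q x) (C x) := by
  have hz : PolyTime fun z : δ × List (ℕ × ℕ) × N => z := PolyTime.id
  have hw : PolyTime fun z : (δ × List (ℕ × ℕ) × N) × (ℕ × ℕ) => z := PolyTime.id
  have hG := polyTime_grid hU.length
  refine hC.foldl (i := fun _ => [(0, 0)])
    (f := fun x T c => extend (grid (U x).length) (admissible a b (p x) (R x) (U x) (q x) c) T)
    (.const _) (polyTime_extend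
      (ok := fun z => admissible a b (p z.1) (R z.1) (U z.1) (q z.1) z.2.2)
      (hG.comp hz.fst) (polyTime_admissible a b (hp.comp hw.fst.fst) (hR.comp hw.fst.fst)
        (hU.comp hw.fst.fst) (hq.comp hw.fst.fst) hw.fst.snd.snd hw.snd) hz.snd.fst)
    hG.bounded fun x T c _ => ?_
  exact (treeSize_le_of_sublist List.filter_sublist).trans (Nat.le_add_left _ _)

theorem polyTime_canWin (a b : ℕ) {C : δ → List N} {p : δ → N} {k : δ → ℕ}
    {R U : δ → List (List N)} (hC : PolyTime C) (hp : PolyTime p) (hk : PolyTime k)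
    (hR : PolyTime R) (hU : PolyTime U) :
    PolyTime fun x => canWin a b (C x) (p x) (k x) (R x) (U x) := by
  have hz : PolyTime fun z : δ × (ℕ × ℕ) => z := PolyTime.id
  have hw : PolyTime fun z : (δ × (ℕ × ℕ)) × (ℕ × ℕ) => z := PolyTime.id
  exact (polyTime_grid hU.length).any (p := fun x q => decide (q.1 + q.2 ≤ k x) &&
      (reachable a b (p x) (R x) (U x) q (C x)).any fun r => decide (r = q)) <|
    ((hz.snd.fst.add hz.snd.snd).le (hk.comp hz.fst)).and <|
    (polyTime_reachable a b (hp.comp hz.fst) (hR.comp hz.fst) (hU.comp hz.fst) hz.snd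
      (hC.comp hz.fst)).any (p := fun z r => decide (r = z.2)) (hw.snd.eq hw.fst.snd)

/-- Truncation after every bit keeps the unary intermediate value at most `n`. -/
theorem polyTime_boundedValue {n : δ → ℕ} {l : δ → List Bool} (hn : PolyTime n)
    (hl : PolyTime l) : PolyTime fun x => boundedValue (n x) (l x) := by
  have hz : PolyTime fun z : δ × ℕ × Bool => z := PolyTime.id
  refine hl.reverse.foldl (i := fun _ => 0)
    (f := fun x m y => min (m + m + if y then 1 else 0) (n x)) (.const _)
    (((hz.snd.fst.add hz.snd.fst).add (hz.snd.snd.ite (.const 1) (.const 0))).min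
      (hn.comp hz.fst)) hn.bounded fun x m y _ => ?_
  simp only [treeSize_nat]
  have := min_le_right (m + m + if y then 1 else 0) (n x)
  omega

end polyTime

/-! ### The values of its parts -/

/-- Early truncation is harmless: doubling a value already cut off at `n` and cutting again gives
the same minimum. -/
theorem boundedValue_encodeNat (n k : ℕ) : boundedValue n (encodeNat k) = min k n := by
  have h : ∀ k : PosNum, boundedValue n (encodePosNum k) = min (k : ℕ) n := by
    intro k
    induction k with
    | one => simp [encodePosNum, boundedValue]
    | bit0 k ih =>
      simp only [boundedValue] at ih
      simp only [encodePosNum, boundedValue, List.reverse_cons, List.foldl_append, ih,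
        List.foldl_cons, List.foldl_nil, PosNum.cast_bit0]
      simp
      omega
    | bit1 k ih =>
      simp only [boundedValue] at ih
      simp only [encodePosNum, boundedValue, List.reverse_cons, List.foldl_append, ih,
        List.foldl_cons, List.foldl_nil, PosNum.cast_bit1]
      simp
      omega
  have h' : ∀ k : Num, boundedValue n (encodeNum k) = min (k : ℕ) n := by
    intro k
    cases k with
    | zero => simp [encodeNum, boundedValue]
    | pos k => simpa [encodeNum] using h k
  simpa [encodeNat] using h' k

theorem mem_grid {n : ℕ} {q : ℕ × ℕ} : q ∈ grid n ↔ q.1 ≤ n ∧ q.2 ≤ n := by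
  obtain ⟨i, j⟩ := q
  simp [grid]

theorem mem_extend {n : ℕ} {ok : ℕ × ℕ → Bool} {T : List (ℕ × ℕ)} {r : ℕ × ℕ} :
    r ∈ extend (grid n) ok T ↔ (r.1 ≤ n ∧ r.2 ≤ n) ∧
      ∃ t ∈ T, ∃ s, ok s = true ∧ t.1 + s.1 = r.1 ∧ t.2 + s.2 = r.2 := by
  obtain ⟨i, j⟩ := r
  simp only [extend, List.mem_filter, List.any_eq_true, Bool.and_eq_true, decide_eq_true_eq,
    mem_grid, Prod.mk.injEq]
  refine and_congr_right fun h => exists_congr fun t => and_congr_right fun _ =>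
    exists_congr fun s => ⟨fun h => h.2, fun h' => ⟨?_, h'⟩⟩
  -- The summand `s` is at most `r` in both components, so its membership in the grid is automatic.
  omega

variable {N : Type} [DecidableEq N]

/-- Partial sums are at most the total, so restricting the table to the grid loses nothing. Without
repetitions in `C`, the choice for a new candidate can be recorded by updating `x` and `y` without
disturbing earlier ones. -/
theorem mem_foldl_extend {n : ℕ} {ok : N → ℕ × ℕ → Bool} {C : List N} (hC : C.Nodup) {r : ℕ × ℕ} :
    r ∈ C.foldl (fun T c => extend (grid n) (ok c) T) [(0, 0)] ↔ (r.1 ≤ n ∧ r.2 ≤ n) ∧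
      ∃ x y : N → ℕ, (∀ c ∈ C, ok c (x c, y c) = true) ∧
        (C.map x).sum = r.1 ∧ (C.map y).sum = r.2 := by
  induction C using List.reverseRecOn generalizing r with
  | nil =>
    obtain ⟨i, j⟩ := r
    simp
    omega
  | append_singleton C c ih =>
    have hC' : C.Nodup := (List.nodup_append.1 hC).1
    have hc : c ∉ C := by
      intro h
      rw [List.nodup_append] at hC
      exact hC.2.2 c h c (by simp) rfl
    rw [List.foldl_append, List.foldl_cons, List.foldl_nil, mem_extend]
    refine and_congr_right fun hr => ⟨?_, ?_⟩
    · rintro ⟨t, ht, s, hs, h1, h2⟩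
      obtain ⟨-, x, y, hxy, hx, hy⟩ := (ih hC').1 ht
      have hne : ∀ d ∈ C, d ≠ c := fun d hd h => hc (h ▸ hd)
      have hmap : ∀ (z : N → ℕ) (m : ℕ), C.map (Function.update z c m) = C.map z := fun z m =>
        List.map_congr_left fun d hd => Function.update_of_ne (hne d hd) _ _
      refine ⟨Function.update x c s.1, Function.update y c s.2, fun d hd => ?_, ?_, ?_⟩
      · rcases List.mem_append.1 hd with hd | hd
        · simpa [hne d hd] using hxy d hd
        · obtain rfl : d = c := by simpa using hd
          simpa using hs
      · simp [hmap, hx, h1]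
      · simp [hmap, hy, h2]
    · rintro ⟨x, y, hxy, hx, hy⟩
      simp only [List.map_append, List.map_cons, List.map_nil, List.sum_append, List.sum_cons,
        List.sum_nil] at hx hy
      exact ⟨((C.map x).sum, (C.map y).sum), (ih hC').2 ⟨by simp only; omega, x, y,
        fun d hd => hxy d (by simp [hd]), rfl, rfl⟩, (x c, y c), hxy c (by simp),
        by simp only; omega,
        by simp only; omega⟩

/-- The guess `q` stands for the two totals; by `hk` totals that respect the limit lie in the grid
that is searched. -/
theorem canWin_iff {a b : ℕ} {C : List N} (hC : C.Nodup) {p : N} {k : ℕ} {R U : List (List N)}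
    (hk : k ≤ U.length) : canWin a b C p k R U = true ↔ ∃ x y : N → ℕ,
      (C.map x).sum + (C.map y).sum ≤ k ∧
      ∀ c ∈ C, x c ≤ pairCount p c U ∧ y c ≤ pairCount c p U ∧
        natScore a b c R + b * x c + a * y c ≤
          natScore a b p R + a * (C.map x).sum + b * (C.map y).sum := by
  simp only [canWin, reachable, List.any_eq_true, Bool.and_eq_true, decide_eq_true_eq, mem_grid,
    exists_eq_right, mem_foldl_extend hC]
  constructor
  · rintro ⟨q, hq, h, -, x, y, hxy, hx, hy⟩
    refine ⟨x, y, by rwa [hx, hy], fun c hc => ?_⟩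
    simpa [admissible, hx, hy] using hxy c hc
  · rintro ⟨x, y, h, hxy⟩
    refine ⟨((C.map x).sum, (C.map y).sum), by simp only; omega, h, by simp only; omega, x, y,
      fun c hc => ?_, rfl, rfl⟩
    simpa [admissible] using hxy c hc

end AddingVoters

/-! ### Correctness of the algorithm -/

namespace AddingVoters

/-- The points of `c` for a vote with `a` points for the first and `b` for the second place. -/
def votePoints (a b : ℕ) (c : ℕ) (v : Vote) : ℕ :=
  if v.head? = some c then a else if v.tail.head? = some c then b else 0

/-- Whether a vote ranks `c` first and `d` second, as a number. -/
def pairIndicator (c d : ℕ) (v : Vote) : ℕ :=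
  if v.head? = some c ∧ v.tail.head? = some d then 1 else 0

/-- The product of the denominators serves as `D`. Being positive, it preserves all comparisons of
scores. -/
theorem exists_nat_scaling {α β : ℚ} (hα : 0 ≤ α) (hβ : 0 ≤ β) :
    ∃ a b D : ℕ, 0 < D ∧ α * D = a ∧ β * D = b := by
  refine ⟨α.num.toNat * β.den, β.num.toNat * α.den, α.den * β.den,
    Nat.mul_pos α.den_pos β.den_pos, ?_, ?_⟩
  · have h : ((α.num.toNat : ℤ) : ℚ) = α.num := by
      rw [Int.toNat_of_nonneg (Rat.num_nonneg.2 hα)]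
    push_cast at h ⊢
    rw [h, ← Rat.mul_den_eq_num α]
    ring
  · have h : ((β.num.toNat : ℤ) : ℚ) = β.num := by
      rw [Int.toNat_of_nonneg (Rat.num_nonneg.2 hβ)]
    push_cast at h ⊢
    rw [h, ← Rat.mul_den_eq_num β]
    ring

theorem points_mul {α β : ℚ} (hβ : 0 ≤ β) (hαβ : β ≤ α) {a b D : ℕ} (ha : α * D = a)
    (hb : β * D = b) (v : Vote) (c : ℕ) :
    (alphaBetaGenerator α β hβ hαβ).points v c * D = votePoints a b c v := by
  unfold ScoringGenerator.points votePoints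
  match v with
  | [] => simp
  | [u] =>
    by_cases hu : u = c <;> simp [alphaBetaGenerator, hu, ha]
  | u :: w :: t =>
    by_cases hu : u = c
    · simp [alphaBetaGenerator, hu, ha]
    · by_cases hw : w = c
      · simp [alphaBetaGenerator, hu, hw, hb]
      · simp [alphaBetaGenerator, hu, hw]

theorem score_mul {α β : ℚ} (hβ : 0 ≤ β) (hαβ : β ≤ α) {a b D : ℕ} (ha : α * D = a)
    (hb : β * D = b) (V : Multiset Vote) (c : ℕ) :
    (alphaBetaGenerator α β hβ hαβ).score V c * D = ((V.map (votePoints a b c)).sum : ℕ) := by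
  unfold ScoringGenerator.score
  induction V using Multiset.induction with
  | empty => simp
  | cons v V ih =>
    rw [Multiset.map_cons, Multiset.sum_cons, add_mul, ih, points_mul hβ hαβ ha hb]
    simp

theorem isWinner_iff {α β : ℚ} (hβ : 0 ≤ β) (hαβ : β ≤ α) {a b D : ℕ} (hD : 0 < D)
    (ha : α * D = a) (hb : β * D = b) {C : List ℕ} {p : ℕ} (hp : p ∈ C) (V : Multiset Vote) :
    (alphaBetaGenerator α β hβ hαβ).IsWinner C V p ↔
      ∀ c ∈ C, (V.map (votePoints a b c)).sum ≤ (V.map (votePoints a b p)).sum := by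
  unfold ScoringGenerator.IsWinner
  refine (and_iff_right hp).trans (forall₂_congr fun c _ => ?_)
  rw [← mul_le_mul_iff_left₀ (by exact_mod_cast hD : (0 : ℚ) < D), score_mul hβ hαβ ha hb,
    score_mul hβ hαβ ha hb, Nat.cast_le]

/-- Without repetitions no vote counts `c` both as first and as second. -/
theorem natScore_eq {a b c : ℕ} {V : List Vote} (hV : ∀ v ∈ V, v.Nodup) :
    natScore a b c V = (V.map (votePoints a b c)).sum := by
  induction V with
  | nil => simp [natScore, firstCount, secondCount]
  | cons v V ih =>
    have hv := hV v (by simp)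
    rw [List.map_cons, List.sum_cons, ← ih fun w hw => hV w (by simp [hw])]
    have hne : v.head? = some c → v.tail.head? ≠ some c := by
      match v with
      | [] => simp
      | [u] => simp
      | u :: w :: t =>
        rintro h1 h2
        simp_all
    simp only [natScore, firstCount, secondCount, List.filter_cons, votePoints, decide_eq_true_eq]
    by_cases h1 : v.head? = some c
    · simp only [h1, hne h1, if_true, if_false, List.length_cons]
      ring
    · by_cases h2 : v.tail.head? = some c <;>
        simp only [h1, h2, if_true, if_false, List.length_cons] <;> ring

theorem pairCount_eq (c d : ℕ) (V : List Vote) :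
    pairCount c d V = (V.map (pairIndicator c d)).sum := by
  induction V with
  | nil => simp [pairCount]
  | cons v V ih =>
    rw [List.map_cons, List.sum_cons, ← ih]
    simp only [pairCount, List.filter_cons, pairIndicator, Bool.and_eq_true, decide_eq_true_eq]
    split_ifs <;> simp [Nat.add_comm]

/-- This forces `x p = y p = 0`, so that `p` may be treated as one of the candidates `c` in all
sums. -/
theorem pairCount_self {c : ℕ} {V : List Vote} (hV : ∀ v ∈ V, v.Nodup) : pairCount c c V = 0 := by
  rw [pairCount, List.length_eq_zero_iff, List.filter_eq_nil_iff]
  intro v hv h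
  have := hV v hv
  match v with
  | [] => simp at h
  | [u] => simp at h
  | u :: w :: t => simp_all

/-- The slack comes from votes without `p` in the first two places; `votePoints_eq` has equality for
all others. -/
theorem le_votePoints (a b : ℕ) {c p : ℕ} (hc : c ≠ p) (v : Vote) :
    b * pairIndicator p c v + a * pairIndicator c p v ≤ votePoints a b c v := by
  match v with
  | [] => simp [pairIndicator]
  | [u] => simp [pairIndicator]
  | u :: w :: t =>
    simp only [pairIndicator, votePoints, List.head?_cons, List.tail_cons, Option.some.injEq]
    split_ifs <;> simp_all

theorem votePoints_eq (a b : ℕ) {c p : ℕ} (hc : c ≠ p) {v : Vote}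
    (hv : v.head? = some p ∨ v.tail.head? = some p) :
    votePoints a b c v = b * pairIndicator p c v + a * pairIndicator c p v := by
  match v with
  | [] => simp at hv
  | [u] =>
    simp only [pairIndicator, votePoints]
    split_ifs <;> simp_all
  | u :: w :: t =>
    simp only [pairIndicator, votePoints, List.head?_cons, List.tail_cons, Option.some.injEq]
      at hv ⊢
    split_ifs <;> simp_all

/-! ### A single vote when `p` has a rival -/

section vote

variable {C : List ℕ} {p : ℕ} {v : Vote}

theorem exists_two (hC : C.Nodup) (hp : p ∈ C) (h2 : ∃ c ∈ C, c ≠ p) (hv : v.Perm C) :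
    ∃ u w t, v = u :: w :: t ∧ u ≠ w ∧ u ∈ C ∧ w ∈ C := by
  obtain ⟨c, hc, hcp⟩ := h2
  rw [← hv.mem_iff] at hp hc
  have hn := hv.nodup_iff.2 hC
  match v with
  | [] => simp at hp
  | [u] =>
    rw [List.mem_singleton] at hp hc
    exact absurd (hc.trans hp.symm) hcp
  | u :: w :: t =>
    refine ⟨u, w, t, rfl, ?_, hv.mem_iff.1 (by simp), hv.mem_iff.1 (by simp)⟩
    rintro rfl
    simp at hn

/-- Only the candidate in the other of the two top places contributes. The rival of `p` ensures that
a second place exists. -/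
theorem sum_pairIndicator (hC : C.Nodup) (hp : p ∈ C) (h2 : ∃ c ∈ C, c ≠ p) (hv : v.Perm C) :
    ∑ c ∈ C.toFinset, pairIndicator p c v = (if v.head? = some p then 1 else 0) ∧
      ∑ c ∈ C.toFinset, pairIndicator c p v = (if v.tail.head? = some p then 1 else 0) := by
  obtain ⟨u, w, t, rfl, -, hu, hw⟩ := exists_two hC hp h2 hv
  constructor
  · by_cases h : u = p <;> simp [pairIndicator, h, hw]
  · by_cases h : w = p <;> simp [pairIndicator, h, hu]

theorem votePoints_self (a b : ℕ) (hC : C.Nodup) (hp : p ∈ C) (h2 : ∃ c ∈ C, c ≠ p)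
    (hv : v.Perm C) : votePoints a b p v = ∑ c ∈ C.toFinset,
      (a * pairIndicator p c v + b * pairIndicator c p v) := by
  obtain ⟨h3, h4⟩ := sum_pairIndicator hC hp h2 hv
  rw [Finset.sum_add_distrib, ← Finset.mul_sum, ← Finset.mul_sum, h3, h4]
  obtain ⟨u, w, t, rfl, hne, -⟩ := exists_two hC hp h2 hv
  simp only [votePoints, List.head?_cons, List.tail_cons, Option.some.injEq]
  split_ifs <;> simp_all

theorem sum_pairIndicator_add (hC : C.Nodup) (hp : p ∈ C) (h2 : ∃ c ∈ C, c ≠ p) (hv : v.Perm C) :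
    ∑ c ∈ C.toFinset, (pairIndicator p c v + pairIndicator c p v) =
      if v.head? = some p ∨ v.tail.head? = some p then 1 else 0 := by
  obtain ⟨h3, h4⟩ := sum_pairIndicator hC hp h2 hv
  rw [Finset.sum_add_distrib, h3, h4]
  obtain ⟨u, w, t, rfl, hne, -⟩ := exists_two hC hp h2 hv
  simp only [List.head?_cons, List.tail_cons, Option.some.injEq]
  split_ifs <;> simp_all

end vote

/-! ### Summation over the chosen votes -/

theorem sum_map_finset_sum {V : Type} (A : Multiset V) (S : Finset ℕ) (f : ℕ → V → ℕ) :
    (A.map fun v => ∑ c ∈ S, f c v).sum = ∑ c ∈ S, (A.map (f c)).sum :=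
  Multiset.sum_map_sum_map A S.1

theorem sum_votePoints_self (a b : ℕ) {C : List ℕ} {p : ℕ} (hC : C.Nodup) (hp : p ∈ C)
    (h2 : ∃ c ∈ C, c ≠ p) {A : Multiset Vote} (hA : ∀ v ∈ A, v.Perm C) :
    (A.map (votePoints a b p)).sum =
      a * (C.map fun c => (A.map (pairIndicator p c)).sum).sum +
      b * (C.map fun c => (A.map (pairIndicator c p)).sum).sum := by
  rw [Multiset.map_congr rfl fun v hv => votePoints_self a b hC hp h2 (hA v hv),
    sum_map_finset_sum, ← List.sum_toFinset _ hC, ← List.sum_toFinset _ hC, Finset.mul_sum,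
    Finset.mul_sum, ← Finset.sum_add_distrib]
  refine Finset.sum_congr rfl fun c _ => ?_
  rw [Multiset.sum_map_add, Multiset.sum_map_mul_left, Multiset.sum_map_mul_left]

theorem card_filter_eq_sum {C : List ℕ} {p : ℕ} (hC : C.Nodup) (hp : p ∈ C)
    (h2 : ∃ c ∈ C, c ≠ p) {A : Multiset Vote} (hA : ∀ v ∈ A, v.Perm C) :
    (A.filter fun v => v.head? = some p ∨ v.tail.head? = some p).card =
      (C.map fun c => (A.map (pairIndicator p c)).sum).sum +
      (C.map fun c => (A.map (pairIndicator c p)).sum).sum := by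
  have h : (A.filter fun v => v.head? = some p ∨ v.tail.head? = some p).card =
      (A.map fun v => if v.head? = some p ∨ v.tail.head? = some p then 1 else 0).sum := by
    induction A using Multiset.induction with
    | empty => simp
    | cons v A ih =>
      rw [Multiset.filter_cons, Multiset.map_cons, Multiset.sum_cons, ← ih fun w hw =>
        hA w (Multiset.mem_cons_of_mem hw)]
      split_ifs <;> simp [Nat.add_comm]
  rw [h, ← Multiset.map_congr rfl fun v hv => sum_pairIndicator_add hC hp h2 (hA v hv),
    sum_map_finset_sum, ← List.sum_toFinset _ hC, ← List.sum_toFinset _ hC,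
    ← Finset.sum_add_distrib]
  exact Finset.sum_congr rfl fun c _ => Multiset.sum_map_add

/-- One can choose prescribed numbers of elements with each value of `key`. -/
theorem exists_le_card_filter {V J : Type} [DecidableEq J] (key : V → J) (U : Multiset V)
    (n : J → ℕ) (h : ∀ j, n j ≤ (U.filter fun v => key v = j).card) :
    ∃ A ≤ U, ∀ j, (A.filter fun v => key v = j).card = n j := by
  induction U using Multiset.induction generalizing n with
  | empty => exact ⟨0, le_rfl, fun j => by simpa [eq_comm] using h j⟩
  | cons v U ih =>
    -- The element `v` is taken exactly if its key is still in demand.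
    cases hn : n (key v) with
    | zero =>
      obtain ⟨A, hA, hcard⟩ := ih n fun j => by
        by_cases hj : key v = j
        · simp [← hj, hn]
        · simpa [Multiset.filter_cons, hj] using h j
      exact ⟨A, hA.trans (Multiset.le_cons_self U v), hcard⟩
    | succ t =>
      obtain ⟨A, hA, hcard⟩ := ih (Function.update n (key v) t) fun j => by
        have := h j
        by_cases hj : key v = j
        · subst hj
          rw [hn, Multiset.filter_cons_of_pos (p := fun w => key w = key v) _ rfl,
            Multiset.card_cons] at this
          simpa using this
        · simpa [Multiset.filter_cons, hj, Function.update_of_ne (Ne.symm hj)] using this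
      refine ⟨v ::ₘ A, Multiset.cons_le_cons v hA, fun j => ?_⟩
      have := hcard j
      by_cases hj : key v = j
      · subst hj
        simp [hn] at this ⊢
        exact this
      · rw [Function.update_of_ne (Ne.symm hj)] at this
        simpa [Multiset.filter_cons, hj] using this

theorem card_filter_pair (c d : ℕ) (A : Multiset Vote) :
    (A.filter fun v => (v.head?, v.tail.head?) = (some c, some d)).card =
      (A.map (pairIndicator c d)).sum := by
  induction A using Multiset.induction with
  | empty => simp
  | cons v A ih =>
    rw [Multiset.map_cons, Multiset.sum_cons, ← ih, Multiset.filter_cons]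
    simp only [pairIndicator, Prod.mk.injEq]
    split_ifs <;> simp [Nat.add_comm]

/-- Only the numbers of chosen votes with each candidate next to `p` on the first two places
matter. -/
theorem exists_votes_iff {a b : ℕ} {C : List ℕ} {p k : ℕ} {R U : List Vote} (hC : C.Nodup)
    (hp : p ∈ C) (hR : ∀ v ∈ R, v.Perm C) (hU : ∀ v ∈ U, v.Perm C) :
    (∃ A : Multiset Vote, A ≤ (U : Multiset Vote) ∧ A.card ≤ k ∧ ∀ c ∈ C,
      (((R : Multiset Vote) + A).map (votePoints a b c)).sum ≤
        (((R : Multiset Vote) + A).map (votePoints a b p)).sum) ↔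
    ∃ x y : ℕ → ℕ, (C.map x).sum + (C.map y).sum ≤ k ∧
      ∀ c ∈ C, x c ≤ pairCount p c U ∧ y c ≤ pairCount c p U ∧
        natScore a b c R + b * x c + a * y c ≤
          natScore a b p R + a * (C.map x).sum + b * (C.map y).sum := by
  have hRn : ∀ v ∈ R, v.Nodup := fun v hv => (hR v hv).nodup_iff.2 hC
  have hUn : ∀ v ∈ U, v.Nodup := fun v hv => (hU v hv).nodup_iff.2 hC
  -- If `p` is the only candidate, both sides hold with nothing added.
  by_cases h2 : ∃ c ∈ C, c ≠ p
  swap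
  · push Not at h2
    refine ⟨fun _ => ⟨fun _ => 0, fun _ => 0, by simp, fun c hc => by simp [h2 c hc]⟩,
      fun _ => ⟨0, Multiset.zero_le _, Nat.zero_le _, fun c hc => by rw [h2 c hc]⟩⟩
  simp only [Multiset.map_add, Multiset.sum_add, Multiset.map_coe, Multiset.sum_coe,
    natScore_eq hRn]
  constructor
  · rintro ⟨A, hAU, hAk, hA⟩
    have hAC : ∀ v ∈ A, v.Perm C := fun v hv => hU v (by simpa using Multiset.mem_of_le hAU hv)
    have hle : ∀ c d, (A.map (pairIndicator c d)).sum ≤ pairCount c d U := by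
      intro c d
      obtain ⟨A', hA'⟩ := Multiset.le_iff_exists_add.1 hAU
      rw [pairCount_eq, ← Multiset.sum_coe, ← Multiset.map_coe, hA', Multiset.map_add,
        Multiset.sum_add]
      exact Nat.le_add_right _ _
    refine ⟨fun c => (A.map (pairIndicator p c)).sum, fun c => (A.map (pairIndicator c p)).sum,
      ?_, fun c hc => ⟨hle p c, hle c p, ?_⟩⟩
    · rw [← card_filter_eq_sum hC hp h2 hAC]
      -- The numbers count only votes with `p` in the first two places; ignoring the others respects
      -- the limit.
      exact (Multiset.card_le_card (Multiset.filter_le _ _)).trans hAk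
    · rcases eq_or_ne c p with rfl | hcp
      · have := hle c c
        rw [pairCount_self hUn] at this
        simp [Nat.le_zero.1 this, Nat.add_assoc]
      · have h3 := hA c hc
        rw [sum_votePoints_self a b hC hp h2 hAC] at h3
        -- Ignoring the other votes can only lower the score of `c`, while that of `p` was just
        -- expressed by counted votes alone.
        have h4 : (A.map fun v => b * pairIndicator p c v + a * pairIndicator c p v).sum ≤
            (A.map (votePoints a b c)).sum :=
          Multiset.sum_map_le_sum_map _ _ fun v _ => le_votePoints a b hcp v
        rw [Multiset.sum_map_add, Multiset.sum_map_mul_left, Multiset.sum_map_mul_left] at h4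
        dsimp only
        omega
  · rintro ⟨x, y, hk, hxy⟩
    have hxp : x p = 0 := by simpa [pairCount_self hUn] using (hxy p hp).1
    have hyp : y p = 0 := by simpa [pairCount_self hUn] using (hxy p hp).2.1
    have hcount : ∀ c d, (((U : Multiset Vote).filter
        fun v => (v.head?, v.tail.head?) = (some c, some d)).card) = pairCount c d U := by
      intro c d
      rw [card_filter_pair, pairCount_eq, Multiset.map_coe, Multiset.sum_coe]
    -- The demand for each pair of top places. It is zero for pairs without `p`, and also outside
    -- `C`, where `x` and `y` are unconstrained.
    let n : Option ℕ × Option ℕ → ℕ := fun j =>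
      match j with
      | (some u, some w) =>
        if u = p then if w ∈ C then x w else 0 else if w = p ∧ u ∈ C then y u else 0
      | _ => 0
    obtain ⟨A, hAU, hA⟩ := exists_le_card_filter (fun v : Vote => (v.head?, v.tail.head?))
      (U : Multiset Vote) n (by
        rintro ⟨_ | u, _ | w⟩
        · exact Nat.zero_le _
        · exact Nat.zero_le _
        · exact Nat.zero_le _
        · rw [hcount]
          by_cases hu : u = p
          · subst hu
            by_cases hw : w ∈ C
            · simpa [n, hw] using (hxy w hw).1
            · simp [n, hw]
          · by_cases hw : w = p ∧ u ∈ C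
            · obtain ⟨rfl, hw⟩ := hw
              simpa [n, hu, hw] using (hxy u hw).2.1
            · simp [n, hu, hw])
    have hAC : ∀ v ∈ A, v.Perm C := fun v hv => hU v (by simpa using Multiset.mem_of_le hAU hv)
    have hx : ∀ c ∈ C, (A.map (pairIndicator p c)).sum = x c := fun c hc => by
      rw [← card_filter_pair, hA]
      simp [n, hc]
    have hy : ∀ c ∈ C, (A.map (pairIndicator c p)).sum = y c := fun c hc => by
      rw [← card_filter_pair, hA]
      rcases eq_or_ne c p with rfl | hcp
      · simp [n, hc, hxp, hyp]
      · simp [n, hc, hcp]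
    -- Since `n` vanishes on all other pairs, `A` contains no further votes; its size and scores are
    -- then exact.
    have hAp : ∀ v ∈ A, v.head? = some p ∨ v.tail.head? = some p := by
      intro v hv
      by_contra hvp
      push Not at hvp
      have h3 : n (v.head?, v.tail.head?) = 0 := by
        obtain ⟨u, w, t, rfl, -⟩ := exists_two hC hp h2 (hAC v hv)
        simp only [List.head?_cons, List.tail_cons, ne_eq, Option.some.injEq] at hvp
        simp [n, hvp]
      have h4 := hA (v.head?, v.tail.head?)
      rw [h3, Multiset.card_eq_zero, Multiset.filter_eq_nil] at h4
      exact h4 v hv rfl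
    have hX : (C.map fun c => (A.map (pairIndicator p c)).sum) = C.map x := List.map_congr_left hx
    have hY : (C.map fun c => (A.map (pairIndicator c p)).sum) = C.map y := List.map_congr_left hy
    refine ⟨A, hAU, ?_, fun c hc => ?_⟩
    · have := card_filter_eq_sum hC hp h2 hAC
      rw [Multiset.filter_eq_self.2 hAp, hX, hY] at this
      omega
    · rcases eq_or_ne c p with rfl | hcp
      · exact le_rfl
      · rw [sum_votePoints_self a b hC hp h2 hAC, hX, hY,
          Multiset.map_congr rfl fun v hv => votePoints_eq a b hcp (hAp v hv),
          Multiset.sum_map_add, Multiset.sum_map_mul_left, Multiset.sum_map_mul_left, hx c hc,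
          hy c hc]
        have := (hxy c hc).2.2
        omega

/-- The decision procedure for instances. -/
def decideInstance (a b : ℕ) (I : CCAVInstance) : Bool :=
  canWin (N := BinaryNat) a b I.cands I.p (boundedValue I.U.length (encodeNat I.k)) I.R I.U

theorem polyTime_decideInstance (a b : ℕ) : PolyTime (decideInstance a b) :=
  polyTime_canWin (N := BinaryNat) a b CCAVInstance.polyTime_cands CCAVInstance.polyTime_p
    (polyTime_boundedValue (PolyTime.length (β := List BinaryNat) CCAVInstance.polyTime_U)
      CCAVInstance.polyTime_k) CCAVInstance.polyTime_R CCAVInstance.polyTime_U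

theorem decideInstance_iff {α β : ℚ} (hβ : 0 ≤ β) (hαβ : β ≤ α) {a b D : ℕ} (hD : 0 < D)
    (ha : α * D = a) (hb : β * D = b) (I : CCAVInstance) :
    decideInstance a b I = true ↔ CCAV (alphaBetaGenerator α β hβ hαβ) I := by
  have hk : boundedValue I.U.length (encodeNat I.k) = min I.k I.U.length :=
    boundedValue_encodeNat _ _
  -- `BinaryNat` is `ℕ` by definition and differs only in its code, so correctness is proved over
  -- `ℕ`.
  refine ((canWin_iff (N := ℕ) I.cands_nodup (hk.trans_le (min_le_right _ _))).trans
    (exists_votes_iff I.cands_nodup I.p_mem I.R_perm I.U_perm).symm).trans ?_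
  rw [hk]
  unfold CCAV
  refine exists_congr fun A => and_congr_right fun hA => and_congr ?_
    (isWinner_iff hβ hαβ hD ha hb I.p_mem _).symm
  -- A sub-multiset of `U` has at most `U.length` members, so truncating `k` changes nothing.
  have := Multiset.card_le_card hA
  simp only [Multiset.coe_card] at this
  omega

end AddingVoters

end

theorem mainTheorem11 (α β : ℚ) (hβ : 0 ≤ β) (hαβ : β ≤ α) :
    SolvableInPolyTime CCAVInstance.encoding (CCAV (alphaBetaGenerator α β hβ hαβ)) := by
  obtain ⟨a, b, D, hD, ha, hb⟩ := AddingVoters.exists_nat_scaling (hβ.trans hαβ) hβ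
  exact (AddingVoters.polyTime_decideInstance a b).solvableInPolyTime CCAVInstance.encoding
    (fun _ => rfl) (AddingVoters.decideInstance_iff hβ hαβ hD ha hb)
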